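/- Let $\alpha\in(0,1)$ be irrational with continued fraction expansion $\alpha=[0;1+d_1,d_2,d_3,\ldots]$, where all $d_i\ge 1$. Let $a_1=1+d_1$ and $a_i=d_i$ for $i\ge 2$, and for $n\ge 0$ and an integer $k\ge 1-a_{n+1}$ put $\alpha_{n,k}=[0;a_{n+1}+k,a_{n+2},a_{n+3},\ldots]$. For irrational $\gamma\in(0,1)$ let $c_\gamma$ be the characteristic Sturmian word over $\{a,b\}$ of slope $\gamma$: its letter at position $i\ge 0$ is $a$ if $\lfloor (i+2)\gamma\rfloor=\lfloor (i+1)\gamma\rfloor$, and $b$ otherwise. We say that a sequence is given by $c_\gamma$ over the alphabet $\{x,y\}$ if it arises from $c_\gamma$ by replacing $a$ by $x$ and $b$ by $y$. Words are regarded as elements of the free group on $\{a,b\}$, and $\widetilde v$ is the reversal of $v$. Let $s_{-1}=b$, $s_0=a$, $s_n=s_{n-1}^{d_n}s_{n-2}$ for $n\ge 1$. Let $w_{-2}=v_{-2}=\varepsilon$ and $w_{-1}=a$. For $n\ge 0$ let $w_n=as_nb^{-1}$ if $n$ is odd and $w_n=bs_na^{-1}$ if $n$ is even; for $n\ge -1$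 let $v_n=as_{n+1}^{d_{n+2}-1}s_nb^{-1}$ if $n$ is odd and $v_n=bs_{n+1}^{d_{n+2}-1}s_na^{-1}$ if $n$ is even. For $n\ge 0$ and $0\le k\le d_{n+1}-1$ let $$U_{n,k}=(w_{n-1}v_{n-2})^kw_{n-1},\qquad \overline U_{n,k}=(v_{n-2}w_{n-1})^kv_{n-2},$$ and put $U_{n,-1}=(v_{n-2})^{-1}$, $\overline U_{n,-1}=(w_{n-1})^{-1}$. Let $u$ be a palindromic factor of $c_\alpha$ with $|u|\ge 2$. Below, an identity $c_\alpha=p\,u^{(1)}z_1u^{(2)}z_2u^{(3)}z_3\cdots$ means that $u^{(i)}$ is the $i$-th occurrence of $u$ in $c_\alpha$ (all occurrences are listed, and there are infinitely many), that $p$ is the prefix of $c_\alpha$ preceding the first occurrence, and that, in the free group, $uz_i$ is the factor of $c_\alpha$ from the beginning of the $i$-th occurrence up to the beginning of the $(i+1)$-st one (so $z_i$ is the inverse of a non-empty word if these two occurrences overlap, and a word otherwise). (1) If $u=vU_{n,k}\widetilde v$ for some $n\ge 1$, some proper suffix $v$ of $v_{n-2}$ and some $0\le k\le d_{n+1}-2$,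 then $$c_\alpha=\Bigl(\prod_{j=-1}^{n-2}v_j\Bigr)v^{-1}u^{(1)}z_1u^{(2)}z_2u^{(3)}z_3\cdots,$$ where $z_1z_2z_3\cdots$ is given by $c_{\alpha_{n,-k}}$ over the alphabet $\{(vU_{n,k-1}\widetilde v)^{-1},\ \widetilde v^{-1}w_nv^{-1}\}$. (2) If $u=v\overline U_{n,k}\widetilde v$ for some $n\ge 1$, some proper suffix $v$ of $w_{n-1}$ and some $0\le k\le d_{n+1}-1$, then $$c_\alpha=\Bigl(\prod_{j=-1}^{n-3}v_j\Bigr)v^{-1}u^{(1)}z_1u^{(2)}z_2u^{(3)}z_3\cdots,$$ where $z_1z_2z_3\cdots$ is given by $c_{\alpha_{n,1-k}}$ over the alphabet $\{(v\overline U_{n,k-1}\widetilde v)^{-1},\ (vU_{n-1,d_n-2}\widetilde v)^{-1}\}$. (3) If $u=a^k$ for some $2\le k\le d_1-1$, then $c_\alpha=u^{(1)}z_1u^{(2)}z_2u^{(3)}z_3\cdots$, where $z_1z_2z_3\cdots$ is given by $c_{\alpha_{0,-k}}$ over the alphabet $\{(a^{k-1})^{-1},\ b\}$. Moreover, every palindromic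 factor $u$ of $c_\alpha$ with $|u|\ge 2$ has (at least) one of the forms in (1), (2), (3). (In (1) and (2) a proper suffix may be empty; the empty product is $\varepsilon$.) -/

import Mathlib

namespace SturmianPalindromes

/-! ### Words over the alphabet `{a, b}` -/

/-- The two-letter alphabet. -/
inductive Letter where
  | a : Letter
  | b : Letter
  deriving DecidableEq

/-- Finite words. -/
abbrev Word := List Letter

/-- The power `x ^ m` of a finite word. -/
def wordPow (x : Word) (m : ℕ) : Word := (List.replicate m x).flatten

/-- The embedding of the free monoid of words into the free group. -/
def toGroup (x : Word) : FreeGroup Letter := (x.map FreeGroup.of).prod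

/-- The finite word `c i, c (i+1), …, c (j-1)` read off an infinite word `c`. -/
def segment (c : ℕ → Letter) (i j : ℕ) : Word := (List.range (j - i)).map fun t => c (i + t)

/-- The finite word `u` occurs at position `i` of the infinite word `c`. -/
def OccursAt (u : Word) (c : ℕ → Letter) (i : ℕ) : Prop := segment c i (i + u.length) = u

/-- The finite word `u` is a factor of the infinite word `c`. -/
def IsFactor (u : Word) (c : ℕ → Letter) : Prop := ∃ i, OccursAt u c i

/-- The word `x` is a proper suffix of `y`. -/
def IsProperSuffix (x y : Word) : Prop := x <:+ y ∧ x ≠ y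

/-- The sequence obtained from the infinite word `t` by replacing `a` by `x` and `b` by `y`,
i.e. the word `t` "over the alphabet `{x, y}`". -/
def overAlphabet {G : Type*} (t : ℕ → Letter) (x y : G) (i : ℕ) : G :=
  match t i with
  | Letter.a => x
  | Letter.b => y

/-- The decomposition `c = p u⁽¹⁾ z₁ u⁽²⁾ z₂ u⁽³⁾ z₃ ⋯`, where `u⁽ⁱ⁾` is the `i`-th occurrence of
`u` in `c`, and where `p` and the `zᵢ` are elements of the free group (`z i` is `zᵢ₊₁`).
Here `pos 0 < pos 1 < ⋯` are exactly all the positions at which `u` occurs in `c`; `p` is the prefix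
of `c` that precedes the first occurrence, and `u zᵢ` is the part of `c` from the beginning of the
`i`-th occurrence up to the beginning of the next one. If these two occurrences overlap, then
`zᵢ` is the inverse of a word. -/
def IsOccurrenceDecomposition (c : ℕ → Letter) (p : FreeGroup Letter) (u : Word)
    (z : ℕ → FreeGroup Letter) : Prop :=
  ∃ pos : ℕ → ℕ, StrictMono pos ∧ (∀ i, OccursAt u c i ↔ ∃ m, pos m = i) ∧
    p = toGroup (segment c 0 (pos 0)) ∧
    ∀ m, toGroup u * z m = toGroup (segment c (pos m) (pos (m + 1)))

/-! ### Characteristic Sturmian words and continued fractions -/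

/-- The characteristic word `c_γ` of slope `γ`, i.e. `s_{γ,0}` without its first letter, where
`s_{γ,0} n` is `a` if `⌊(n + 1) γ⌋ - ⌊n γ⌋ = 0` and `b` otherwise. -/
noncomputable def charWord (γ : ℝ) (n : ℕ) : Letter :=
  if ⌊((n : ℝ) + 2) * γ⌋ - ⌊((n : ℝ) + 1) * γ⌋ = 0 then Letter.a else Letter.b

/-- `γ = [0; e 0, e 1, e 2, …]` is the (infinite, simple) continued fraction expansion of `γ`. -/
def HasContFrac (γ : ℝ) (e : ℕ → ℤ) : Prop :=
  GenContFract.of γ = ⟨0, Stream'.Seq.ofStream fun i => ⟨1, (e i : ℝ)⟩⟩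

/-- The partial quotients of `α = [0; 1 + d₁, d₂, d₃, …]`: the value at `i ≥ 1` is the `i`-th one.
(The values of `d` and of this function at `0` are irrelevant.) -/
def partQuot (d : ℕ → ℕ) (i : ℕ) : ℤ := if i = 1 then 1 + d 1 else d i

/-- The sequence `(a_{n+1} + k, a_{n+2}, a_{n+3}, …)` for the partial quotients `aᵢ` of
`α = [0; 1 + d₁, d₂, d₃, …]`; it is the sequence of partial quotients of `α_{n,k}`.
For `n = k = 0` it is the sequence of partial quotients of `α`. -/
def shiftQuot (d : ℕ → ℕ) (n : ℕ) (k : ℤ) (i : ℕ) : ℤ :=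
  if i = 0 then partQuot d (n + 1) + k else partQuot d (n + 1 + i)

/-- A real number is determined by its infinite continued fraction expansion. -/
theorem HasContFrac.unique {γ γ' : ℝ} {e : ℕ → ℤ} (h : HasContFrac γ e) (h' : HasContFrac γ' e) :
    γ = γ' := by
  have h1 := GenContFract.of_convergence γ
  have h2 := GenContFract.of_convergence γ'
  unfold HasContFrac at h h'
  rw [h] at h1
  rw [h'] at h2
  exact tendsto_nhds_unique h1 h2

/-! ### Standard words, singular words, adjoining singular words

All of them are indexed by integers `n ≥ -1` or `n ≥ -2`, as is customary. -/

/-- Auxiliary, with shifted index: `stdWordAux d m` is `s_{m-1}`. -/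
def stdWordAux (d : ℕ → ℕ) : ℕ → Word
  | 0 => [Letter.b]
  | 1 => [Letter.a]
  | m + 2 => wordPow (stdWordAux d (m + 1)) (d (m + 1)) ++ stdWordAux d m

/-- The standard words: `s_{-1} = b`, `s_0 = a`, `s_n = s_{n-1} ^ d_n s_{n-2}` for `n ≥ 1`. -/
def stdWord (d : ℕ → ℕ) (n : ℤ) : Word := stdWordAux d (n + 1).toNat

/-- The singular words: `w_{-2}` is empty, `w_{-1} = a`, and for `n ≥ 0` the word `w_n` is
`a s_n b⁻¹` if `n` is odd and `b s_n a⁻¹` if `n` is even. -/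
def singWord (d : ℕ → ℕ) (n : ℤ) : Word :=
  if n ≤ -2 then [] else if n = -1 then [Letter.a]
  else if Odd n then Letter.a :: (stdWord d n).dropLast
  else Letter.b :: (stdWord d n).dropLast

/-- The adjoining singular words: `v_{-2}` is empty, and for `n ≥ -1` the word `v_n` is
`a s_{n+1} ^ (d_{n+2} - 1) s_n b⁻¹` if `n` is odd and `b s_{n+1} ^ (d_{n+2} - 1) s_n a⁻¹` if `n` is
even. -/
def adjWord (d : ℕ → ℕ) (n : ℤ) : Word :=
  if n ≤ -2 then []
  else if Odd n then
    Letter.a :: (wordPow (stdWord d (n + 1)) (d (n + 2).toNat - 1) ++ stdWord d n).dropLast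
  else
    Letter.b :: (wordPow (stdWord d (n + 1)) (d (n + 2).toNat - 1) ++ stdWord d n).dropLast

/-- The product `∏_{j=-1}^{m-2} v_j = v_{-1} v_0 ⋯ v_{m-2}` of the first `m` adjoining singular
words. -/
def adjProd (d : ℕ → ℕ) (m : ℕ) : Word :=
  ((List.range m).map fun i => adjWord d ((i : ℤ) - 1)).flatten

/-- `U_{n,k} = (w_{n-1} v_{n-2}) ^ k w_{n-1}` as a word, for `k ≥ 0`. -/
def wordU (d : ℕ → ℕ) (n k : ℕ) : Word :=
  wordPow (singWord d (n - 1) ++ adjWord d (n - 2)) k ++ singWord d (n - 1)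

/-- `Ū_{n,k} = (v_{n-2} w_{n-1}) ^ k v_{n-2}` as a word, for `k ≥ 0`. -/
def wordUbar (d : ℕ → ℕ) (n k : ℕ) : Word :=
  wordPow (adjWord d (n - 2) ++ singWord d (n - 1)) k ++ adjWord d (n - 2)

/-- `U_{n,k}` in the free group, for `k ≥ -1`, with the convention `U_{n,-1} = (v_{n-2})⁻¹`. -/
def groupU (d : ℕ → ℕ) (n : ℕ) (k : ℤ) : FreeGroup Letter :=
  if k = -1 then (toGroup (adjWord d (n - 2)))⁻¹ else toGroup (wordU d n k.toNat)

/-- `Ū_{n,k}` in the free group, for `k ≥ -1`, with the convention `Ū_{n,-1} = (w_{n-1})⁻¹`. -/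
def groupUbar (d : ℕ → ℕ) (n : ℕ) (k : ℤ) : FreeGroup Letter :=
  if k = -1 then (toGroup (singWord d (n - 1)))⁻¹ else toGroup (wordUbar d n k.toNat)

/-! The removal of the last letter in `singWord` and `adjWord` is the multiplication by the inverse
of the letter named in their descriptions. -/

theorem stdWordAux_last (d : ℕ → ℕ) (m : ℕ) :
    ∃ l, stdWordAux d m = l ++ [if Odd m then Letter.a else Letter.b] := by
  induction m using Nat.twoStepInduction with
  | zero => exact ⟨[], by simp [stdWordAux]⟩
  | one => exact ⟨[], by simp [stdWordAux]⟩
  | more m h _ =>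
    obtain ⟨l, hl⟩ := h
    refine ⟨wordPow (stdWordAux d (m + 1)) (d (m + 1)) ++ l, ?_⟩
    have : Odd (m + 2) ↔ Odd m := by grind
    simp [stdWordAux, hl, this]

theorem stdWord_last (d : ℕ → ℕ) (n : ℤ) (hn : -1 ≤ n) :
    ∃ l, stdWord d n = l ++ [if Odd n then Letter.b else Letter.a] := by
  obtain ⟨l, hl⟩ := stdWordAux_last d (n + 1).toNat
  refine ⟨l, ?_⟩
  have : Odd (n + 1).toNat ↔ ¬ Odd n := by
    obtain ⟨m, hm⟩ : ∃ m : ℕ, n = m - 1 := ⟨(n + 1).toNat, by omega⟩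
    subst hm
    have h : ((m : ℤ) - 1 + 1).toNat = m := by omega
    rw [h, ← Int.odd_coe_nat]
    grind
  unfold stdWord
  rw [hl]
  by_cases h : Odd n <;> simp [this, h]

theorem toGroup_append (x y : Word) : toGroup (x ++ y) = toGroup x * toGroup y := by
  simp [toGroup]

theorem toGroup_dropLast (y : Word) (x : Word) (t : Letter) (h : ∃ l, x = l ++ [t]) :
    toGroup ((y ++ x).dropLast) = toGroup (y ++ x) * (FreeGroup.of t)⁻¹ := by
  obtain ⟨l, rfl⟩ := h
  rw [← List.append_assoc, List.dropLast_concat, toGroup_append (y ++ l)]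
  simp [toGroup]

theorem toGroup_cons (t : Letter) (x : Word) :
    toGroup (t :: x) = FreeGroup.of t * toGroup x := by
  simp [toGroup]

theorem toGroup_singWord (d : ℕ → ℕ) (n : ℤ) (hn : 0 ≤ n) :
    toGroup (singWord d n) =
      if Odd n then FreeGroup.of Letter.a * toGroup (stdWord d n) * (FreeGroup.of Letter.b)⁻¹
      else FreeGroup.of Letter.b * toGroup (stdWord d n) * (FreeGroup.of Letter.a)⁻¹ := by
  have h1 : ¬ n ≤ -2 := by omega
  have h2 : ¬ n = -1 := by omega
  have h3 := toGroup_dropLast [] _ _ (stdWord_last d n (by omega))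
  simp only [List.nil_append] at h3
  unfold singWord
  by_cases h : Odd n <;> simp only [h, h1, h2, if_true, if_false] at h3 ⊢ <;>
    rw [toGroup_cons, h3, mul_assoc]

theorem toGroup_adjWord (d : ℕ → ℕ) (n : ℤ) (hn : -1 ≤ n) :
    toGroup (adjWord d n) =
      if Odd n then FreeGroup.of Letter.a *
        toGroup (wordPow (stdWord d (n + 1)) (d (n + 2).toNat - 1) ++ stdWord d n) *
          (FreeGroup.of Letter.b)⁻¹
      else FreeGroup.of Letter.b *
        toGroup (wordPow (stdWord d (n + 1)) (d (n + 2).toNat - 1) ++ stdWord d n) *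
          (FreeGroup.of Letter.a)⁻¹ := by
  have h1 : ¬ n ≤ -2 := by omega
  have h3 := toGroup_dropLast (wordPow (stdWord d (n + 1)) (d (n + 2).toNat - 1)) _ _
    (stdWord_last d n hn)
  unfold adjWord
  by_cases h : Odd n <;> simp only [h, h1, if_true, if_false] at h3 ⊢ <;>
    rw [toGroup_cons, h3, mul_assoc]

end SturmianPalindromes

open SturmianPalindromes

/-!
The characteristic word of `α = [0; 1 + d₁, d₂, …]` is, for every `n`, the image under the morphism
`a ↦ s_n`, `b ↦ s_{n-1}` of the characteristic word `t` of `[0; 1 + d_{n+1}, d_{n+2}, …]`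
(`HasContFrac.exists_level`), and `t` arises from the word `c_{α_{n,-k}}` (for `n = 0`, from
`c_{α_{0,-k-1}}`) by inserting `a ^ (k + 1)` before every `b` (`HasContFrac.exists_run`). About real
numbers only two facts are needed: replacing `1 / γ` by `1 + 1 / γ` inserts one `a` before every
`b`, and replacing `γ` by `1 - γ` exchanges the two letters.

All these morphisms are compositions of the exchange of the letters and of `a ↦ a`, `b ↦ ab`. For
each of them there is a word `C` such that the occurrences of `φ (u) C` in `φ (t)` are exactly the
images of the occurrences of `u` in `t`; moreover, a word `x φ (u) C x'`, with one more letter on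
either side, already determines the letters of `t` around `u`. These properties, collected in
`Recognizable`, are stable under composition. For `a ↦ s_n`, `b ↦ s_{n-1}`, the word `C` is the
central word `s_n s_{n-1}` without its last two letters. Consequently the occurrences of `U_{n,k}`,
which is of the form `x s_n ^ (k-1) C x` if `k ≥ 1` and a singular word if `k = 0`, all stem from
the occurrences of `a ^ (k + 1)` in `t`, and extend to occurrences of the central word
`s_n ^ (k+1) C = p U_{n,k} p̃`, where `p = v_{-1} v_0 ⋯ v_{n-2}` is `s_n` without its last letter
(`exists_of_occursAt_wordU`, `central_eq`). Hence all the palindromes `v U_{n,k} ṽ` with a suffix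
`v` of `p` have the same occurrences up to a shift, and the words from one occurrence to the next
are conjugates of `s_n` and `s_n ^ (k+1) s_{n-1}`, in the order given by `c_{α_{n,-k}}`
(`isOccurrenceDecomposition_wordU`). The cases of the theorem are these palindromes for
`k < d_{n+1}`, since `Ū_{n,k} = v_{n-2} U_{n,k-1} v_{n-2}` and `Ū_{n,0} = v_{n-2} = U_{n-1,d_n-1}`.

Every palindromic factor is of this form by induction on its length
(`exists_wordU_of_palindrome`): removing the first and the last letter of a palindrome gives either
a word `v U_{n,k} ṽ` in which `v` is shorter than `p`, and which extends uniquely; or a full central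
word, whose palindromic extensions are again words `U_{n',k'}`, because the lengths of the blocks of
letters `a` in `t` are `d_{n+1}` and `d_{n+1} + 1`.
-/

namespace SturmianPalindromes

/-! ### Occurrences of finite words in infinite words -/

theorem occursAt_nil (c : ℕ → Letter) (i : ℕ) : OccursAt [] c i := by
  simp [OccursAt, segment]

theorem segment_self (c : ℕ → Letter) (i : ℕ) : segment c i i = [] := by
  simp [segment]

theorem segment_cons (c : ℕ → Letter) (i n : ℕ) :
    segment c i (i + (n + 1)) = c i :: segment c (i + 1) (i + 1 + n) := by
  simp only [segment, Nat.add_sub_cancel_left, List.range_succ_eq_map, List.map_cons, List.map_map,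
    add_zero, List.cons.injEq, true_and, List.map_inj_left, Function.comp_apply]
  intro t _
  congr 1
  omega

theorem segment_append (c : ℕ → Letter) (i m n : ℕ) :
    segment c i (i + m) ++ segment c (i + m) (i + m + n) = segment c i (i + (m + n)) := by
  induction m generalizing i with
  | zero => simp [segment_self]
  | succ m ih =>
    rw [segment_cons, List.cons_append, show i + (m + 1 + n) = i + (m + n + 1) by omega,
      segment_cons, ← ih]
    grind

theorem occursAt_cons {x : Letter} {u : Word} {c : ℕ → Letter} {i : ℕ} :
    OccursAt (x :: u) c i ↔ c i = x ∧ OccursAt u c (i + 1) := by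
  simp [OccursAt, segment_cons]

theorem occursAt_singleton {x : Letter} {c : ℕ → Letter} {i : ℕ} :
    OccursAt [x] c i ↔ c i = x := by
  simp [occursAt_cons, occursAt_nil]

theorem occursAt_append {u v : Word} {c : ℕ → Letter} {i : ℕ} :
    OccursAt (u ++ v) c i ↔ OccursAt u c i ∧ OccursAt v c (i + u.length) := by
  induction u generalizing i with
  | nil => simp [occursAt_nil]
  | cons x u ih =>
    rw [List.cons_append, occursAt_cons, occursAt_cons, ih, and_assoc, List.length_cons,
      show i + 1 + u.length = i + (u.length + 1) by omega]

theorem occursAt_replicate {x : Letter} {n : ℕ} {c : ℕ → Letter} {i : ℕ} :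
    OccursAt (List.replicate n x) c i ↔ ∀ j < n, c (i + j) = x := by
  induction n generalizing i with
  | zero => simp [occursAt_nil]
  | succ n ih =>
    rw [List.replicate_succ, occursAt_cons, ih]
    constructor
    · rintro ⟨h0, h⟩ (_ | j) hj
      · simpa using h0
      · rw [show i + (j + 1) = i + 1 + j by omega]
        exact h j (by omega)
    · intro h
      refine ⟨by simpa using h 0 (by omega), fun j hj => ?_⟩
      rw [show i + 1 + j = i + (j + 1) by omega]
      exact h _ (by omega)

theorem OccursAt.eq_of_length {u v : Word} {c : ℕ → Letter} {i : ℕ} (hu : OccursAt u c i)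
    (hv : OccursAt v c i) (h : u.length = v.length) : u = v := by
  unfold OccursAt at hu hv
  rw [← hu, ← hv, h]

/-! ### Morphic images of infinite words -/

/-- The image of a finite word under the morphism `φ`. -/
def subst (φ : Letter → Word) (w : Word) : Word := w.flatMap φ

@[simp] theorem subst_nil (φ : Letter → Word) : subst φ [] = [] := rfl

@[simp] theorem subst_cons (φ : Letter → Word) (x : Letter) (w : Word) :
    subst φ (x :: w) = φ x ++ subst φ w := rfl

@[simp] theorem subst_append (φ : Letter → Word) (u v : Word) :
    subst φ (u ++ v) = subst φ u ++ subst φ v := by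
  simp [subst]

theorem subst_replicate (φ : Letter → Word) (n : ℕ) (x : Letter) :
    subst φ (List.replicate n x) = wordPow (φ x) n := by
  simp [subst, wordPow, List.flatMap, List.map_replicate]

/-- The composition of the morphisms `ψ` and `φ`, with `ψ` applied first. -/
def substComp (φ ψ : Letter → Word) (x : Letter) : Word := subst φ (ψ x)

theorem subst_substComp (φ ψ : Letter → Word) (w : Word) :
    subst (substComp φ ψ) w = subst φ (subst ψ w) := by
  induction w with
  | nil => rfl
  | cons x w ih => simp [ih, substComp]

/-- The position in `φ (t)` at which the image of the letter `t m` begins. -/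
def blockPos (φ : Letter → Word) (t : ℕ → Letter) : ℕ → ℕ
  | 0 => 0
  | m + 1 => blockPos φ t m + (φ (t m)).length

/-- The infinite word `c` is the image `φ (t)` of the infinite word `t`. -/
def IsImage (φ : Letter → Word) (t c : ℕ → Letter) : Prop :=
  ∀ m, OccursAt (φ (t m)) c (blockPos φ t m)

section Image

variable {φ ψ : Letter → Word} {t t₁ c : ℕ → Letter}

theorem blockPos_add_length {u : Word} {m : ℕ} (hu : OccursAt u t m) :
    blockPos φ t (m + u.length) = blockPos φ t m + (subst φ u).length := by
  induction u generalizing m with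
  | nil => simp
  | cons x u ih =>
    obtain ⟨hx, hu⟩ := occursAt_cons.1 hu
    have := ih hu
    rw [List.length_cons, show m + (u.length + 1) = m + 1 + u.length by omega, this]
    simp [blockPos, hx, add_assoc]

theorem IsImage.occursAt_subst (h : IsImage φ t c) {u : Word} {m : ℕ} (hu : OccursAt u t m) :
    OccursAt (subst φ u) c (blockPos φ t m) := by
  induction u generalizing m with
  | nil => exact occursAt_nil _ _
  | cons x u ih =>
    obtain ⟨hx, hu⟩ := occursAt_cons.1 hu
    have := ih hu
    rw [blockPos, hx] at this
    rw [subst_cons, occursAt_append]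
    exact ⟨hx ▸ h m, this⟩

theorem blockPos_substComp (h : IsImage ψ t t₁) (m : ℕ) :
    blockPos (substComp φ ψ) t m = blockPos φ t₁ (blockPos ψ t m) := by
  induction m with
  | zero => rfl
  | succ m ih => simp only [blockPos, ih, blockPos_add_length (h m), substComp]

theorem IsImage.comp (h₁ : IsImage φ t₁ c) (h : IsImage ψ t t₁) :
    IsImage (substComp φ ψ) t c := by
  intro m
  rw [blockPos_substComp h]
  exact h₁.occursAt_subst (h m)

theorem blockPos_strictMono (hφ : ∀ x, φ x ≠ []) : StrictMono (blockPos φ t) :=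
  strictMono_nat_of_lt_succ fun m => by
    have := List.length_pos_iff.2 (hφ (t m))
    simp only [blockPos]
    omega

/-- Every position of a morphic image lies in the image of some letter. -/
theorem exists_eq_blockPos_add (hφ : ∀ x, φ x ≠ []) (t : ℕ → Letter) (i : ℕ) :
    ∃ m j, i = blockPos φ t m + j ∧ j < (φ (t m)).length := by
  induction i with
  | zero => exact ⟨0, 0, rfl, List.length_pos_iff.2 (hφ _)⟩
  | succ i ih =>
    obtain ⟨m, j, rfl, hj⟩ := ih
    by_cases h : j + 1 < (φ (t m)).length
    · exact ⟨m, j + 1, rfl, h⟩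
    · refine ⟨m + 1, 0, ?_, List.length_pos_iff.2 (hφ _)⟩
      simp only [blockPos]
      omega

theorem segment_blockPos (h : IsImage φ t c) (m : ℕ) :
    segment c (blockPos φ t m) (blockPos φ t (m + 1)) = φ (t m) := h m

end Image

/-- Every infinite word `substComp φ ψ (t)` is the image under `φ` of the infinite word `ψ (t)`. -/
theorem IsImage.exists_intermediate {φ ψ : Letter → Word} (hψ : ∀ x, ψ x ≠ [])
    {t c : ℕ → Letter} (h : IsImage (substComp φ ψ) t c) :
    ∃ t₁, IsImage ψ t t₁ ∧ IsImage φ t₁ c := by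
  -- The letter of `ψ (t)` at position `i` is the letter at position `j i` of `ψ (t (m i))`.
  choose m j hmj using exists_eq_blockPos_add hψ t
  have hinj : ∀ m j m' j', j < (ψ (t m)).length → j' < (ψ (t m')).length →
      blockPos ψ t m + j = blockPos ψ t m' + j' → m = m' ∧ j = j' := by
    intro m j m' j' hj hj' he
    have hs := blockPos_strictMono (t := t) hψ
    have h1 : ¬ m < m' := fun hlt => by
      have := hs.monotone (Nat.succ_le_of_lt hlt)
      simp only [blockPos] at this
      omega
    have h2 : ¬ m' < m := fun hlt => by
      have := hs.monotone (Nat.succ_le_of_lt hlt)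
      simp only [blockPos] at this
      omega
    have : m = m' := by omega
    subst this
    exact ⟨rfl, by omega⟩
  have ht₁ : IsImage ψ t (fun i => (ψ (t (m i)))[j i]'(hmj i).2) := by
    intro k
    unfold OccursAt segment
    apply List.ext_getElem
    · simp
    · intro l h1 h2
      have h3 := hinj _ _ _ _ h2 (hmj (blockPos ψ t k + l)).2 (hmj (blockPos ψ t k + l)).1
      simp only [List.getElem_map, List.getElem_range]
      grind
  refine ⟨_, ht₁, ?_⟩
  intro i
  set t₁ : ℕ → Letter := fun i => (ψ (t (m i)))[j i]'(hmj i).2 with ht₁_def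
  obtain ⟨hi, hj⟩ := hmj i
  have h1 := h (m i)
  have h2 := ht₁ (m i)
  rw [blockPos_substComp ht₁] at h1
  unfold substComp at h1
  obtain ⟨p, q, hpq, hp⟩ : ∃ p q, ψ (t (m i)) = p ++ t₁ i :: q ∧ p.length = j i := by
    refine ⟨(ψ (t (m i))).take (j i), (ψ (t (m i))).drop (j i + 1), ?_, ?_⟩
    · simp [ht₁_def]
    · simp only [List.length_take]
      omega
  rw [hpq] at h1 h2
  rw [subst_append, occursAt_append, subst_cons, occursAt_append] at h1
  have h3 := blockPos_add_length (φ := φ) (occursAt_append.1 h2).1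
  rw [hp, ← hi] at h3
  rw [h3]
  exact h1.2.1

/-! ### Recognizable morphisms -/

/-- A morphism `φ` with the properties of a standard Sturmian morphism. The word `C` is a common
prefix of all the words `φ (t)` such that the occurrences of `φ (u) C` in `φ (t)` are exactly the
images of the occurrences of `u` in `t`. The letter `e x` is the last letter of `φ x`, and also the
letter that follows the prefix `C` of `φ (x) C`; an occurrence of `e x φ (u) C e y` stems from an
occurrence of `x u y`. The reversal of `φ (u) C` is `φ (ũ) C`, so that palindromes are mapped to
palindromes. -/
structure Recognizable (φ : Letter → Word) (C : Word) (e : Letter → Letter) : Prop where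
  ne_nil : ∀ x, φ x ≠ []
  lift : ∀ {t c}, IsImage φ t c → ∀ m, OccursAt C c (blockPos φ t m)
  sync : ∀ {t c}, IsImage φ t c → ∀ {u i}, OccursAt (subst φ u ++ C) c i →
    ∃ m, OccursAt u t m ∧ i = blockPos φ t m
  core : ∀ {t c}, IsImage φ t c → ∀ {u x y i}, OccursAt (e x :: (subst φ u ++ C ++ [e y])) c i →
    ∃ m, OccursAt (x :: (u ++ [y])) t m ∧ i + 1 = blockPos φ t (m + 1)
  reverse : ∀ u, (subst φ u ++ C).reverse = subst φ u.reverse ++ C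

theorem Recognizable.comp {φ ψ : Letter → Word} {C C' : Word} {e e' : Letter → Letter}
    (hφ : Recognizable φ C e) (hψ : Recognizable ψ C' e') :
    Recognizable (substComp φ ψ) (subst φ C' ++ C) (e ∘ e') := by
  refine ⟨fun x => ?_, fun {t c} h m => ?_, fun {t c} h {u i} hu => ?_,
    fun {t c} h {u x y i} hu => ?_, fun u => ?_⟩
  · have := hψ.ne_nil x
    unfold substComp
    cases h : ψ x with
    | nil => exact absurd h this
    | cons y w => simp [hφ.ne_nil]
  · obtain ⟨t₁, h1, h2⟩ := h.exists_intermediate hψ.ne_nil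
    rw [blockPos_substComp h1, occursAt_append]
    have h3 := hψ.lift h1 m
    refine ⟨h2.occursAt_subst h3, ?_⟩
    rw [← blockPos_add_length h3]
    exact hφ.lift h2 _
  · obtain ⟨t₁, h1, h2⟩ := h.exists_intermediate hψ.ne_nil
    rw [subst_substComp, ← List.append_assoc, ← subst_append] at hu
    obtain ⟨m₁, hm₁, rfl⟩ := hφ.sync h2 hu
    obtain ⟨m, hm, rfl⟩ := hψ.sync h1 hm₁
    exact ⟨m, hm, (blockPos_substComp h1 m).symm⟩
  · obtain ⟨t₁, h1, h2⟩ := h.exists_intermediate hψ.ne_nil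
    rw [subst_substComp, ← List.append_assoc, ← subst_append] at hu
    obtain ⟨m₁, hm₁, hi⟩ := hφ.core h2 hu
    obtain ⟨m, hm, hm'⟩ := hψ.core h1 hm₁
    exact ⟨m, hm, by rw [hi, hm', blockPos_substComp h1]⟩
  · rw [subst_substComp, ← List.append_assoc, ← subst_append, hφ.reverse, hψ.reverse,
      subst_append, subst_substComp, List.append_assoc]

/-- The exchange of the two letters. -/
def flip : Letter → Letter
  | Letter.a => Letter.b
  | Letter.b => Letter.a

@[simp] theorem flip_flip (x : Letter) : flip (flip x) = x := by cases x <;> rfl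

theorem blockPos_singleton (σ : Letter → Letter) (t : ℕ → Letter) (m : ℕ) :
    blockPos (fun x => [σ x]) t m = m := by
  induction m with
  | zero => rfl
  | succ m ih => simp [blockPos, ih]

theorem isImage_singleton {σ : Letter → Letter} {t c : ℕ → Letter} :
    IsImage (fun x => [σ x]) t c ↔ ∀ m, c m = σ (t m) := by
  simp [IsImage, blockPos_singleton, occursAt_singleton]

/-- A permutation of the letters is recognizable. -/
theorem recognizable_perm {σ : Letter → Letter} (hσ : Function.Injective σ) :
    Recognizable (fun x => [σ x]) [] σ := by
  have sync : ∀ {t c : ℕ → Letter}, IsImage (fun x => [σ x]) t c → ∀ {u i},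
      OccursAt (subst (fun x => [σ x]) u) c i → OccursAt u t i := by
    intro t c h u i hu
    rw [isImage_singleton] at h
    induction u generalizing i with
    | nil => exact occursAt_nil _ _
    | cons x u ih =>
      rw [subst_cons, occursAt_append, occursAt_singleton, h] at hu
      exact occursAt_cons.2 ⟨hσ hu.1, ih hu.2⟩
  refine ⟨fun x => by simp, fun _ m => occursAt_nil _ _, fun {t c} h {u i} hu => ?_,
    fun {t c} h {u x y i} hu => ?_, fun u => ?_⟩
  · rw [List.append_nil] at hu
    exact ⟨i, sync h hu, by rw [blockPos_singleton]⟩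
  · refine ⟨i, sync h ?_, by rw [blockPos_singleton]⟩
    simpa using hu
  · induction u with
    | nil => rfl
    | cons x u ih =>
      simp only [List.append_nil] at ih
      simp [ih]

/-- The morphism `a ↦ a`, `b ↦ a ^ j b`. -/
def runMorph (j : ℕ) : Letter → Word
  | Letter.a => [Letter.a]
  | Letter.b => List.replicate j Letter.a ++ [Letter.b]

theorem runMorph_ne_nil (j : ℕ) (x : Letter) : runMorph j x ≠ [] := by
  cases x <;> simp [runMorph]

theorem recognizable_runMorph_one : Recognizable (runMorph 1) [Letter.a] id := by
  have hne := runMorph_ne_nil 1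
  have start : ∀ {t c : ℕ → Letter}, IsImage (runMorph 1) t c → ∀ m,
      c (blockPos (runMorph 1) t m) = Letter.a := by
    intro t c h m
    have := h m
    cases htm : t m <;> simp_all [runMorph, occursAt_cons, occursAt_nil]
  have hA : ∀ {t c : ℕ → Letter}, IsImage (runMorph 1) t c → ∀ {i}, c i = Letter.a →
      ∃ m, i = blockPos (runMorph 1) t m := by
    intro t c h i hi
    obtain ⟨m, j, rfl, hj⟩ := exists_eq_blockPos_add hne t i
    have := h m
    refine ⟨m, ?_⟩
    cases htm : t m
    · simp_all [runMorph]
    · rcases j with _ | _ | j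
      · rfl
      · simp_all [runMorph, occursAt_cons]
      · simp [runMorph, htm] at hj
  have second : ∀ {t c : ℕ → Letter}, IsImage (runMorph 1) t c → ∀ m,
      c (blockPos (runMorph 1) t m + 1) = t m := by
    intro t c h m
    have h1 := h m
    have h2 := start h (m + 1)
    cases htm : t m <;> simp_all [runMorph, occursAt_cons, occursAt_nil, blockPos]
  have sync : ∀ {t c : ℕ → Letter}, IsImage (runMorph 1) t c → ∀ {u i},
      OccursAt (subst (runMorph 1) u ++ [Letter.a]) c i →
      ∃ m, OccursAt u t m ∧ i = blockPos (runMorph 1) t m := by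
    intro t c h u i hu
    induction u generalizing i with
    | nil =>
      obtain ⟨m, hm⟩ := hA h (occursAt_singleton.1 hu)
      exact ⟨m, occursAt_nil _ _, hm⟩
    | cons x u ih =>
      rw [subst_cons, List.append_assoc, occursAt_append] at hu
      obtain ⟨hx, hu⟩ := hu
      obtain ⟨m', hm', hi'⟩ := ih hu
      have hs := start h m'
      have hia : c i = Letter.a := by
        cases x <;> simp_all [runMorph, occursAt_cons]
      obtain ⟨m, rfl⟩ := hA h hia
      have h2 := second h m
      have hxm : t m = x := by
        rw [← h2]
        cases x
        · rw [runMorph, List.length_singleton] at hi'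
          rw [hi']
          exact hs
        · rw [runMorph, occursAt_append, occursAt_singleton] at hx
          exact hx.2
      have : m' = m + 1 := (blockPos_strictMono (t := t) hne).injective (by
        rw [← hi', blockPos, hxm])
      subst this
      exact ⟨m, occursAt_cons.2 ⟨hxm, hm'⟩, rfl⟩
  refine ⟨hne, fun h m => occursAt_singleton.2 (start h m), sync,
    fun {t c} h {u x y i} hu => ?_, fun u => ?_⟩
  · rw [occursAt_cons, occursAt_append, occursAt_singleton] at hu
    obtain ⟨hx, hu, hy⟩ := hu
    obtain ⟨m', hm', hi⟩ := sync h hu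
    have hm0 : m' ≠ 0 := by
      rintro rfl
      simp [blockPos] at hi
    obtain ⟨m, rfl⟩ := Nat.exists_eq_succ_of_ne_zero hm0
    refine ⟨m, occursAt_cons.2 ⟨?_, occursAt_append.2 ⟨hm', occursAt_singleton.2 ?_⟩⟩, hi⟩
    · have h1 := h m
      simp only [blockPos] at hi
      cases htm : t m
      · simp_all [runMorph]
      · have : i = blockPos (runMorph 1) t m + 1 := by
          simp [runMorph, htm] at hi
          omega
        simp_all [runMorph]
    · rw [List.length_append, hi, ← add_assoc, ← blockPos_add_length hm'] at hy
      exact (second h _).symm.trans hy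
  · induction u with
    | nil => rfl
    | cons x u ih =>
      cases x
      · simp_all [runMorph]
      · simp_all [runMorph]

theorem runMorph_zero : runMorph 0 = fun x => [id x] := by
  funext x
  cases x <;> rfl

theorem runMorph_succ (j : ℕ) : runMorph (j + 1) = substComp (runMorph j) (runMorph 1) := by
  funext x
  cases x
  · rfl
  · simp [runMorph, substComp, List.replicate_succ]

theorem recognizable_runMorph (j : ℕ) :
    Recognizable (runMorph j) (List.replicate j Letter.a) id := by
  induction j with
  | zero =>
    rw [runMorph_zero]
    exact recognizable_perm Function.injective_id
  | succ j ih =>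
    have := ih.comp recognizable_runMorph_one
    rw [← runMorph_succ] at this
    exact this

/-- The morphism `a ↦ a ^ j b`, `b ↦ a`. -/
def flipRunMorph (j : ℕ) : Letter → Word := substComp (runMorph j) fun x => [flip x]

theorem recognizable_flipRunMorph (j : ℕ) :
    Recognizable (flipRunMorph j) (List.replicate j Letter.a) flip :=
  (recognizable_runMorph j).comp
    (recognizable_perm (Function.LeftInverse.injective flip_flip))

theorem flipRunMorph_a (j : ℕ) :
    flipRunMorph j Letter.a = List.replicate j Letter.a ++ [Letter.b] := by
  simp [flipRunMorph, substComp, flip, runMorph]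

theorem flipRunMorph_b (j : ℕ) : flipRunMorph j Letter.b = [Letter.a] := by
  simp [flipRunMorph, substComp, flip, runMorph]

/-- In a word `runMorph j (t)`, every letter `b` is the last letter of the image of a letter `b`,
and thus preceded by `a ^ j`. -/
theorem IsImage.runMorph_b {j : ℕ} {t c : ℕ → Letter} (h : IsImage (runMorph j) t c) {i : ℕ}
    (hi : c i = Letter.b) :
    ∃ m, t m = Letter.b ∧ i + 1 = blockPos (runMorph j) t (m + 1) ∧ j ≤ i ∧
      ∀ l < j, c (i - j + l) = Letter.a := by
  obtain ⟨m, l, rfl, hl⟩ := exists_eq_blockPos_add (runMorph_ne_nil j) t i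
  have hm := h m
  refine ⟨m, ?_⟩
  cases htm : t m
  · simp_all [runMorph, occursAt_cons]
  · rw [htm, runMorph, occursAt_append, occursAt_replicate] at hm
    simp only [htm, runMorph, List.length_append, List.length_replicate, List.length_singleton]
      at hl
    have hlj : l = j := by
      by_contra hne
      have := hm.1 l (by omega)
      simp_all
    subst hlj
    refine ⟨rfl, by simp [blockPos, htm, runMorph, add_assoc], by omega, fun l' hl' => ?_⟩
    rw [Nat.add_sub_cancel]
    exact hm.1 l' hl'

/-! ### Standard words and central words -/

theorem wordPow_zero (x : Word) : wordPow x 0 = [] := rfl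

theorem wordPow_succ (x : Word) (m : ℕ) : wordPow x (m + 1) = x ++ wordPow x m := by
  simp [wordPow, List.replicate_succ]

theorem wordPow_singleton (x : Letter) (m : ℕ) : wordPow [x] m = List.replicate m x := by
  induction m with
  | zero => rfl
  | succ m ih => rw [wordPow_succ, ih, List.replicate_succ, List.singleton_append]

theorem wordPow_conj (x y z : Word) (h : x ++ z = z ++ y) (m : ℕ) :
    wordPow x m ++ z = z ++ wordPow y m := by
  induction m with
  | zero => simp [wordPow]
  | succ m ih =>
    rw [wordPow_succ, wordPow_succ, List.append_assoc, ih, ← List.append_assoc, h,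
      List.append_assoc]

/-- The last letter of the standard word `stdWordAux d m`. -/
def lastLetter (m : ℕ) : Letter := if Odd m then Letter.a else Letter.b

theorem lastLetter_add_two (m : ℕ) : lastLetter (m + 2) = lastLetter m := by
  have : Odd (m + 2) ↔ Odd m := by grind
  simp [lastLetter, this]

/-- The standard word `stdWordAux d m` without its last letter. -/
def stdInit (d : ℕ → ℕ) (m : ℕ) : Word := (stdWordAux d m).dropLast

theorem stdWordAux_eq (d : ℕ → ℕ) (m : ℕ) : stdWordAux d m = stdInit d m ++ [lastLetter m] := by
  obtain ⟨l, hl⟩ := stdWordAux_last d m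
  rw [stdInit, hl, List.dropLast_concat]
  rfl

theorem stdInit_add_two (d : ℕ → ℕ) (m : ℕ) :
    stdInit d (m + 2) = wordPow (stdWordAux d (m + 1)) (d (m + 1)) ++ stdInit d m := by
  rw [stdInit, stdWordAux, stdWordAux_eq d m, ← List.append_assoc, List.dropLast_concat]

/-- The central words `s_n s_{n-1}` without the last two letters, by a recursion that also covers
the words `s_{n-1}` of length `1`. -/
def centralWord (d : ℕ → ℕ) : ℕ → Word
  | 0 => []
  | n + 1 => wordPow (stdWordAux d (n + 1)) (d (n + 1)) ++ centralWord d n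

/-- The words `s_n s_{n-1}` and `s_{n-1} s_n` differ only in their last two letters. -/
theorem centralWord_append (d : ℕ → ℕ) (n : ℕ) :
    centralWord d n ++ [lastLetter (n + 1), lastLetter n] =
        stdWordAux d (n + 1) ++ stdWordAux d n ∧
      centralWord d n ++ [lastLetter n, lastLetter (n + 1)] =
        stdWordAux d n ++ stdWordAux d (n + 1) := by
  induction n with
  | zero => exact ⟨rfl, rfl⟩
  | succ n ih =>
    have hpow := wordPow_conj (stdWordAux d (n + 1)) (stdWordAux d (n + 1))
      (stdWordAux d (n + 1)) rfl (d (n + 1))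
    simp only [centralWord, stdWordAux, lastLetter_add_two, List.append_assoc, ih.1, ih.2, true_and]
    rw [← List.append_assoc, hpow, List.append_assoc]

theorem centralWord_append_lastLetter (d : ℕ → ℕ) (n : ℕ) :
    centralWord d n ++ [lastLetter (n + 1)] =
      stdInit d (n + 1) ++ lastLetter (n + 1) :: stdInit d n := by
  have h := (centralWord_append d n).1
  rw [stdWordAux_eq, stdWordAux_eq] at h
  apply List.append_cancel_right (bs := [lastLetter n])
  simpa using h

theorem stdInit_prefix_centralWord (d : ℕ → ℕ) (n : ℕ) :
    stdInit d n <+: centralWord d n := by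
  have h := (centralWord_append d n).2
  rw [stdWordAux_eq, stdWordAux_eq] at h
  have h' : centralWord d n ++ [lastLetter n] =
      stdInit d n ++ ([lastLetter n] ++ stdInit d (n + 1)) := by
    apply List.append_cancel_right (bs := [lastLetter (n + 1)])
    simpa using h
  have h1 : stdInit d n <+: centralWord d n ++ [lastLetter n] := ⟨_, h'.symm⟩
  refine List.prefix_of_prefix_length_le h1 (List.prefix_append _ _) ?_
  have := congrArg List.length h'
  simp at this
  omega

theorem stdInit_succ_prefix_centralWord (d : ℕ → ℕ) (n : ℕ) :
    stdInit d (n + 1) <+: centralWord d n := by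
  have h := centralWord_append_lastLetter d n
  have h1 : stdInit d (n + 1) <+: centralWord d n ++ [lastLetter (n + 1)] := ⟨_, h.symm⟩
  refine List.prefix_of_prefix_length_le h1 (List.prefix_append _ _) ?_
  have := congrArg List.length h
  simp at this
  omega

/-! ### The morphism `a ↦ s_n`, `b ↦ s_{n-1}` -/

/-- The morphism `a ↦ s_n`, `b ↦ s_{n-1}`. -/
def stdMorph (d : ℕ → ℕ) (n : ℕ) : Letter → Word
  | Letter.a => stdWordAux d (n + 1)
  | Letter.b => stdWordAux d n

theorem stdMorph_zero (d : ℕ → ℕ) : stdMorph d 0 = fun x => [id x] := by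
  funext x
  cases x <;> rfl

theorem stdMorph_succ (d : ℕ → ℕ) (n : ℕ) :
    stdMorph d (n + 1) = substComp (stdMorph d n) (flipRunMorph (d (n + 1))) := by
  funext x
  cases x
  · simp [stdMorph, substComp, flipRunMorph_a, subst_replicate, stdWordAux]
  · simp [stdMorph, substComp, flipRunMorph_b]

/-- The last letter of the image of a letter under `stdMorph d n`. -/
def stdLast (n : ℕ) : Letter → Letter
  | Letter.a => lastLetter (n + 1)
  | Letter.b => lastLetter n

theorem stdLast_zero : stdLast 0 = id := by
  funext x
  cases x <;> rfl

theorem stdLast_succ (n : ℕ) : stdLast (n + 1) = stdLast n ∘ flip := by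
  funext x
  cases x
  · exact lastLetter_add_two n
  · rfl

theorem stdLast_surjective (n : ℕ) : Function.Surjective (stdLast n) := by
  induction n with
  | zero =>
    rw [stdLast_zero]
    exact Function.surjective_id
  | succ n ih =>
    rw [stdLast_succ]
    exact ih.comp (Function.RightInverse.surjective flip_flip)

theorem recognizable_stdMorph (d : ℕ → ℕ) (n : ℕ) :
    Recognizable (stdMorph d n) (centralWord d n) (stdLast n) := by
  induction n with
  | zero =>
    rw [stdMorph_zero, stdLast_zero]
    exact recognizable_perm Function.injective_id
  | succ n ih =>
    have := ih.comp (recognizable_flipRunMorph (d (n + 1)))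
    rw [← stdMorph_succ, ← stdLast_succ, subst_replicate] at this
    exact this

theorem centralWord_reverse (d : ℕ → ℕ) (n : ℕ) :
    (centralWord d n).reverse = centralWord d n := by
  simpa using (recognizable_stdMorph d n).reverse []

/-- Central words are palindromes, and have `s_{n-1}` and `s_n` without their last letters as
prefixes. -/
theorem centralWord_eq (d : ℕ → ℕ) (n : ℕ) :
    centralWord d n = stdInit d n ++ (stdInit d (n + 1)).reverse := by
  obtain ⟨r, hr⟩ := stdInit_succ_prefix_centralWord d n
  have h1 : centralWord d n = r.reverse ++ (stdInit d (n + 1)).reverse := by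
    rw [← List.reverse_append, hr, centralWord_reverse]
  have h2 : r.reverse = stdInit d n := by
    have h3 : r.reverse <+: centralWord d n := ⟨_, h1.symm⟩
    have h4 := congrArg List.length (centralWord_append_lastLetter d n)
    rw [← hr] at h4
    have h5 : r.reverse.length = (stdInit d n).length := by
      simp at h4 ⊢
      omega
    exact (List.prefix_of_prefix_length_le h3 (stdInit_prefix_centralWord d n) h5.le).eq_of_length
      h5
  rw [h1, h2]

/-! ### Singular words -/

theorem singWord_eq (d : ℕ → ℕ) (n : ℕ) :
    singWord d ((n : ℤ) - 1) = lastLetter (n + 1) :: stdInit d n := by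
  unfold singWord
  rw [if_neg (by omega)]
  cases n with
  | zero => rfl
  | succ n =>
    have h1 : ((n + 1 : ℕ) : ℤ) - 1 = n := by push_cast; ring
    have h2 : ((n : ℤ) + 1).toNat = n + 1 := by omega
    rw [h1, if_neg (by omega), lastLetter_add_two, stdWord, h2, stdInit, lastLetter]
    simp only [Int.odd_coe_nat]
    split_ifs <;> rfl

theorem adjWord_eq (d : ℕ → ℕ) (n : ℕ) :
    adjWord d ((n : ℤ) - 1) = lastLetter (n + 1) ::
      (wordPow (stdWordAux d (n + 1)) (d (n + 1) - 1) ++ stdInit d n) := by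
  unfold adjWord
  have h2 : ((n : ℤ) - 1 + 1 + 1).toNat = n + 1 := by omega
  have h3 : ((n : ℤ) - 1 + 1).toNat = n := by omega
  have h4 : ((n : ℤ) - 1 + 2).toNat = n + 1 := by omega
  have h5 : Odd ((n : ℤ) - 1) ↔ Odd (n + 1) := by
    rw [← Int.odd_coe_nat]
    push_cast
    grind
  have h6 : (wordPow (stdWordAux d (n + 1)) (d (n + 1) - 1) ++ stdWordAux d n).dropLast =
      wordPow (stdWordAux d (n + 1)) (d (n + 1) - 1) ++ stdInit d n := by
    rw [stdWordAux_eq d n, ← List.append_assoc, List.dropLast_concat]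
  rw [if_neg (by omega), stdWord, stdWord, h2, h3, h4, h6, lastLetter]
  simp only [h5]
  split_ifs <;> rfl

theorem cast_succ_sub_two (n : ℕ) : ((n + 1 : ℕ) : ℤ) - 2 = (n : ℤ) - 1 := by
  push_cast
  ring

theorem stdInit_append_adjWord {d : ℕ → ℕ} (hd : ∀ i, 1 ≤ i → 1 ≤ d i) (n : ℕ) :
    stdInit d (n + 1) ++ adjWord d ((n : ℤ) - 1) = stdInit d (n + 2) := by
  obtain ⟨e, he⟩ := Nat.exists_eq_add_of_le' (hd (n + 1) (by omega))
  rw [adjWord_eq, stdInit_add_two, he, Nat.add_sub_cancel, wordPow_succ,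
    stdWordAux_eq d (n + 1)]
  simp

theorem adjProd_eq {d : ℕ → ℕ} (hd : ∀ i, 1 ≤ i → 1 ≤ d i) (n : ℕ) :
    adjProd d n = stdInit d (n + 1) := by
  induction n with
  | zero => rfl
  | succ n ih =>
    rw [← stdInit_append_adjWord hd, ← ih, adjProd, adjProd, List.range_succ]
    simp

theorem singWord_append_adjWord {d : ℕ → ℕ} (hd : ∀ i, 1 ≤ i → 1 ≤ d i) (n : ℕ) :
    singWord d ((n : ℤ) - 1) ++ adjWord d ((n : ℤ) - 2) =
      lastLetter (n + 1) :: stdInit d (n + 1) := by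
  rw [singWord_eq]
  cases n with
  | zero => rfl
  | succ n =>
    rw [cast_succ_sub_two, List.cons_append, stdInit_append_adjWord hd]

/-! ### Continued fractions -/

theorem hasContFrac_iff_get {γ : ℝ} {e : ℕ → ℤ} :
    HasContFrac γ e ↔
      ⌊γ⌋ = 0 ∧ ∀ n, (GenContFract.of γ).s.get? n = some ⟨1, (e n : ℝ)⟩ := by
  have h1 : GenContFract.of γ = ⟨(⌊γ⌋ : ℝ), (GenContFract.of γ).s⟩ := rfl
  unfold HasContFrac
  rw [h1, GenContFract.mk.injEq]
  refine and_congr (by norm_cast) ⟨fun h n => ?_, fun h => Stream'.Seq.ext fun n => ?_⟩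
  · rw [show (GenContFract.of γ).s = _ from h]
    rfl
  · rw [show _ = _ from h n]
    rfl

/-- The partial quotients, from the first on, do not depend on the integer part. -/
theorem of_fract_get (x : ℝ) (n : ℕ) :
    (GenContFract.of (Int.fract x)).s.get? n = (GenContFract.of x).s.get? n := by
  cases n with
  | zero =>
    by_cases h : Int.fract x = 0
    · obtain ⟨z, rfl⟩ : ∃ z : ℤ, x = z := ⟨⌊x⌋, eq_of_sub_eq_zero h⟩
      have := GenContFract.of_s_of_int ℝ 0
      rw [h, GenContFract.of_s_of_int, ← Int.cast_zero, this]
    · have h1 := GenContFract.of_s_head h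
      have h2 := GenContFract.of_s_head (v := Int.fract x) (by rwa [Int.fract_fract])
      rw [Int.fract_fract] at h2
      exact h2.trans h1.symm
  | succ n => rw [GenContFract.of_s_succ, GenContFract.of_s_succ, Int.fract_fract]

/-- The recursive description of continued fractions. -/
theorem hasContFrac_iff {γ : ℝ} {e : ℕ → ℤ} :
    HasContFrac γ e ↔ 0 < γ ∧ γ < 1 ∧ ⌊γ⁻¹⌋ = e 0 ∧
      HasContFrac (Int.fract γ⁻¹) fun i => e (i + 1) := by
  rw [hasContFrac_iff_get, hasContFrac_iff_get]
  have key : 0 < γ → γ < 1 → ((GenContFract.of γ).s.get? 0 = some ⟨1, (⌊γ⁻¹⌋ : ℝ)⟩ ∧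
      ∀ n, (GenContFract.of γ).s.get? (n + 1) = (GenContFract.of γ⁻¹).s.get? n) := by
    intro h0 h1
    have hf : Int.fract γ = γ := Int.fract_eq_self.2 ⟨h0.le, h1⟩
    refine ⟨?_, fun n => by rw [GenContFract.of_s_succ, hf]⟩
    have := GenContFract.of_s_head (v := γ) (by rw [hf]; exact h0.ne')
    rw [hf] at this
    exact this
  constructor
  · rintro ⟨h0, h⟩
    obtain ⟨hlo, hlt⟩ := Int.floor_eq_zero_iff.1 h0
    have hpos : 0 < γ := by
      refine lt_of_le_of_ne hlo fun he => ?_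
      have := h 0
      rw [← he, ← Int.cast_zero, GenContFract.of_s_of_int] at this
      cases this
    obtain ⟨k0, k1⟩ := key hpos hlt
    rw [h 0] at k0
    refine ⟨hpos, hlt, ?_, Int.floor_fract _, fun n => ?_⟩
    · have := congrArg GenContFract.Pair.b (Option.some.inj k0)
      simpa using this.symm
    · rw [of_fract_get, ← k1, h]
  · rintro ⟨hpos, hlt, h0, -, h⟩
    obtain ⟨k0, k1⟩ := key hpos hlt
    refine ⟨Int.floor_eq_zero_iff.2 ⟨hpos.le, hlt⟩, fun n => ?_⟩
    cases n with
    | zero => rw [k0, h0]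
    | succ n => rw [k1, ← of_fract_get, h]

theorem HasContFrac.irrational {γ : ℝ} {e : ℕ → ℤ} (h : HasContFrac γ e) : Irrational γ := by
  rintro ⟨q, hq⟩
  obtain ⟨n, hn⟩ := (GenContFract.terminates_iff_rat γ).2 ⟨q, hq.symm⟩
  have := (hasContFrac_iff_get.1 h).2 n
  rw [show _ = _ from hn] at this
  cases this

/-! ### Morphisms between characteristic words -/

theorem floor_add_two_mul_sub {γ : ℝ} (h0 : 0 < γ) (h1 : γ < 1) (m : ℕ) :
    ⌊((m : ℝ) + 1) * γ⌋ ≤ ⌊((m : ℝ) + 2) * γ⌋ ∧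
      ⌊((m : ℝ) + 2) * γ⌋ ≤ ⌊((m : ℝ) + 1) * γ⌋ + 1 := by
  constructor
  · exact Int.floor_le_floor (by nlinarith)
  · rw [← Int.floor_add_one]
    exact Int.floor_le_floor (by nlinarith)

/-- If `1 / γ' = 1 + 1 / γ`, then `c_{γ'}` is obtained from `c_γ` by inserting one letter `a` before
every letter `b`. -/
theorem isImage_charWord_div {γ : ℝ} (h0 : 0 < γ) (h1 : γ < 1) :
    IsImage (runMorph 1) (charWord γ) (charWord (γ / (1 + γ))) := by
  have hfl : ∀ (x : ℝ) (F : ℤ), ⌊x * (γ / (1 + γ))⌋ = F ↔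
      F * (1 + γ) ≤ x * γ ∧ x * γ < (F + 1) * (1 + γ) := by
    intro x F
    rw [Int.floor_eq_iff, ← mul_div_assoc, le_div_iff₀ (by linarith), div_lt_iff₀ (by linarith)]
  have hstep := floor_add_two_mul_sub h0 h1
  have hocc : ∀ m p : ℕ, (p : ℤ) = m + ⌊((m : ℝ) + 1) * γ⌋ →
      OccursAt (runMorph 1 (charWord γ m)) (charWord (γ / (1 + γ))) p := by
    intro m p hp
    have hstep := hstep m
    obtain ⟨hF1, hF2⟩ := Int.floor_eq_iff.1 (rfl : ⌊((m : ℝ) + 1) * γ⌋ = _)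
    set F := ⌊((m : ℝ) + 1) * γ⌋ with hF
    have hpR : (p : ℝ) = m + F := by exact_mod_cast hp
    have f1 : ⌊((p : ℝ) + 1) * (γ / (1 + γ))⌋ = F := by
      rw [hfl, hpR]
      constructor <;> nlinarith
    have f2 : ⌊((p : ℝ) + 2) * (γ / (1 + γ))⌋ = F := by
      rw [hfl, hpR]
      constructor <;> nlinarith
    have hfirst : charWord (γ / (1 + γ)) p = Letter.a := by
      unfold charWord
      rw [if_pos (by omega)]
    unfold charWord at hfirst ⊢
    by_cases hm : ⌊((m : ℝ) + 2) * γ⌋ - F = 0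
    · rw [if_pos hm, runMorph, occursAt_singleton]
      exact hfirst
    · rw [if_neg hm]
      have hm' : ⌊((m : ℝ) + 2) * γ⌋ = F + 1 := by omega
      have h2 := (Int.floor_eq_iff.1 hm').1
      push_cast at h2
      have f3 : ⌊((p : ℝ) + 3) * (γ / (1 + γ))⌋ = F + 1 := by
        rw [hfl, hpR]
        push_cast
        constructor <;> nlinarith
      have hsecond : ¬ ⌊(((p + 1 : ℕ) : ℝ) + 2) * (γ / (1 + γ))⌋ -
          ⌊(((p + 1 : ℕ) : ℝ) + 1) * (γ / (1 + γ))⌋ = 0 := by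
        push_cast
        rw [show (p : ℝ) + 1 + 2 = p + 3 by ring, show (p : ℝ) + 1 + 1 = p + 2 by ring, f2, f3]
        omega
      rw [runMorph, occursAt_append, occursAt_singleton, occursAt_replicate]
      refine ⟨fun j hj => ?_, if_neg hsecond⟩
      obtain rfl : j = 0 := by omega
      exact hfirst
  intro m
  refine hocc m _ ?_
  -- The image of the prefix of length `m` contains its letters, and one more for every `b` in it.
  induction m with
  | zero =>
    have hF : ⌊(((0 : ℕ) : ℝ) + 1) * γ⌋ = 0 := by
      rw [Int.floor_eq_zero_iff]
      constructor <;> push_cast <;> linarith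
    rw [hF]
    rfl
  | succ m ih =>
    have := hstep m
    rw [blockPos, Nat.cast_add, ih]
    have e1 : ((m + 1 : ℕ) : ℝ) + 1 = (m : ℝ) + 2 := by push_cast; ring
    rw [e1]
    unfold charWord
    split_ifs with hm
    · simp only [runMorph, List.length_singleton]
      push_cast
      omega
    · simp only [runMorph, List.length_append, List.length_singleton, List.length_replicate]
      push_cast
      omega

theorem charWord_one_sub {γ : ℝ} (h0 : 0 < γ) (h1 : γ < 1) (hγ : Irrational γ) (n : ℕ) :
    charWord (1 - γ) n = flip (charWord γ n) := by
  have key : ∀ k : ℕ, 0 < k → ⌊(k : ℝ) * (1 - γ)⌋ = k - 1 - ⌊(k : ℝ) * γ⌋ := by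
    intro k hk
    have hle := Int.floor_le ((k : ℝ) * γ)
    have hlt := Int.lt_floor_add_one ((k : ℝ) * γ)
    have hne : ((⌊(k : ℝ) * γ⌋ : ℤ) : ℝ) ≠ (k : ℝ) * γ :=
      ((hγ.natCast_mul hk.ne').ne_int _).symm
    have := lt_of_le_of_ne hle hne
    rw [Int.floor_eq_iff]
    push_cast
    constructor <;> linarith
  have k1 := key (n + 1) (by omega)
  have k2 := key (n + 2) (by omega)
  have hstep := floor_add_two_mul_sub h0 h1 n
  push_cast at k1 k2
  unfold charWord
  rw [k1, k2]
  by_cases h : ⌊((n : ℝ) + 2) * γ⌋ - ⌊((n : ℝ) + 1) * γ⌋ = 0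
  · rw [if_pos h, if_neg (by omega)]
    rfl
  · rw [if_neg h, if_pos (by omega)]
    rfl

/-- Decreasing the first partial quotient by `j` removes `j` letters `a` before every `b`. -/
theorem HasContFrac.exists_run {γ : ℝ} {e : ℕ → ℤ} (h : HasContFrac γ e) (j : ℕ)
    (hj : (j : ℤ) < e 0) :
    ∃ γ' : ℝ, HasContFrac γ' (fun i => if i = 0 then e 0 - j else e i) ∧
      IsImage (runMorph j) (charWord γ') (charWord γ) := by
  induction j with
  | zero =>
    refine ⟨γ, ?_, ?_⟩
    · convert h using 2 with i
      split_ifs with hi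
      · simp [hi]
      · rfl
    · rw [runMorph_zero, isImage_singleton]
      exact fun _ => rfl
  | succ j ih =>
    push_cast at hj
    obtain ⟨γ₁, h₁, hi₁⟩ := ih (by omega)
    obtain ⟨hpos, hlt, hfl, htail⟩ := hasContFrac_iff.1 h₁
    simp only [if_true] at hfl
    have hinv : (γ₁ / (1 - γ₁))⁻¹ = γ₁⁻¹ - 1 := by
      have : 1 - γ₁ ≠ 0 := by linarith
      field_simp
    have hge : (2 : ℝ) ≤ γ₁⁻¹ := by
      have := Int.floor_le γ₁⁻¹
      rw [hfl] at this
      have h2 : (2 : ℤ) ≤ e 0 - j := by omega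
      have h2' : (2 : ℝ) ≤ ((e 0 - j : ℤ) : ℝ) := by exact_mod_cast h2
      linarith
    have hirr := h₁.irrational
    have hgt : (2 : ℝ) < γ₁⁻¹ := lt_of_le_of_ne hge (by
      have := hirr.inv.ne_nat 2
      exact_mod_cast this.symm)
    have hpos' : 0 < γ₁ / (1 - γ₁) := div_pos hpos (by linarith)
    have hlt' : γ₁ / (1 - γ₁) < 1 := by
      rw [← one_lt_inv₀ hpos', hinv]
      linarith
    refine ⟨γ₁ / (1 - γ₁), hasContFrac_iff.2 ⟨hpos', hlt', ?_, ?_⟩, ?_⟩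
    · rw [hinv, Int.floor_sub_one, hfl]
      push_cast
      ring
    · rw [hinv, Int.fract_sub_one]
      exact htail
    · have := isImage_charWord_div hpos' hlt'
      have h3 : γ₁ / (1 - γ₁) / (1 + γ₁ / (1 - γ₁)) = γ₁ := by
        have : 1 - γ₁ ≠ 0 := by linarith
        field_simp
        ring
      rw [h3] at this
      rw [runMorph_succ]
      exact hi₁.comp this

/-- The slopes `[0; 1, e₁, e₂, …]` and `[0; 1 + e₁, e₂, …]` add up to `1`. -/
theorem HasContFrac.exists_flip {γ : ℝ} {e : ℕ → ℤ} (h : HasContFrac γ e) (he : e 0 = 1) :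
    ∃ γ' : ℝ, HasContFrac γ' (fun i => if i = 0 then e 1 + 1 else e (i + 1)) ∧
      ∀ m, charWord γ m = flip (charWord γ' m) := by
  obtain ⟨hpos, hlt, hfl, htail⟩ := hasContFrac_iff.1 h
  obtain ⟨fpos, flt, ffl, ftail⟩ := hasContFrac_iff.1 htail
  have hinv : γ⁻¹ = 1 + Int.fract γ⁻¹ := by
    have := Int.floor_add_fract γ⁻¹
    rw [hfl, he] at this
    push_cast at this
    exact this.symm
  have hinv' : (1 - γ)⁻¹ = (Int.fract γ⁻¹)⁻¹ + 1 := by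
    have h1 : 1 - γ = Int.fract γ⁻¹ / (1 + Int.fract γ⁻¹) := by
      have : 1 + Int.fract γ⁻¹ ≠ 0 := by linarith
      rw [eq_div_iff this, ← hinv, sub_mul, mul_inv_cancel₀ hpos.ne']
      linarith
    rw [h1, inv_div, add_div, div_self fpos.ne', one_div]
  refine ⟨1 - γ, hasContFrac_iff.2 ⟨by linarith, by linarith, ?_, ?_⟩, fun m => ?_⟩
  · rw [hinv', Int.floor_add_one, ffl]
    simp
  · rw [hinv', Int.fract_add_one]
    exact ftail
  · rw [charWord_one_sub hpos hlt h.irrational, flip_flip]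

/-- The partial quotients `1 + d_{n+1}, d_{n+2}, d_{n+3}, …`. -/
def levelQuot (d : ℕ → ℕ) (n : ℕ) (i : ℕ) : ℤ :=
  if i = 0 then d (n + 1) + 1 else d (n + 1 + i)

theorem shiftQuot_zero (d : ℕ → ℕ) (k : ℤ) :
    shiftQuot d 0 k = fun i => if i = 0 then levelQuot d 0 0 + k else levelQuot d 0 i := by
  funext i
  unfold shiftQuot levelQuot partQuot
  simp only [zero_add]
  split_ifs <;> omega

theorem shiftQuot_succ (d : ℕ → ℕ) (n : ℕ) (k : ℤ) :
    shiftQuot d (n + 1) k =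
      fun i => if i = 0 then levelQuot d (n + 1) 0 - 1 + k else levelQuot d (n + 1) i := by
  funext i
  unfold shiftQuot levelQuot partQuot
  split_ifs <;> omega

/-- The characteristic word of slope `[0; 1 + d_{n+1}, d_{n+2}, …]` is the image of that of slope
`[0; 1 + d_{n+2}, d_{n+3}, …]` under `a ↦ a ^ d_{n+1} b`, `b ↦ a`. -/
theorem HasContFrac.exists_flipRun {d : ℕ → ℕ} {γ : ℝ} {n : ℕ}
    (h : HasContFrac γ (levelQuot d n)) :
    ∃ γ' : ℝ, HasContFrac γ' (levelQuot d (n + 1)) ∧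
      IsImage (flipRunMorph (d (n + 1))) (charWord γ') (charWord γ) := by
  obtain ⟨γ₁, h₁, hi₁⟩ := h.exists_run (d (n + 1)) (by simp [levelQuot])
  obtain ⟨γ', h', hi'⟩ := h₁.exists_flip (by simp [levelQuot])
  refine ⟨γ', ?_, hi₁.comp (isImage_singleton.2 hi')⟩
  convert h' using 2 with i
  simp [levelQuot, add_comm, add_left_comm]

theorem HasContFrac.exists_level {d : ℕ → ℕ} {α : ℝ} (h : HasContFrac α (levelQuot d 0)) (n : ℕ) :
    ∃ γ : ℝ, HasContFrac γ (levelQuot d n) ∧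
      IsImage (stdMorph d n) (charWord γ) (charWord α) := by
  induction n with
  | zero =>
    refine ⟨α, h, ?_⟩
    rw [stdMorph_zero, isImage_singleton]
    exact fun _ => rfl
  | succ n ih =>
    obtain ⟨γ, hγ, hi⟩ := ih
    obtain ⟨γ', hγ', hi'⟩ := hγ.exists_flipRun
    rw [stdMorph_succ]
    exact ⟨γ', hγ', hi.comp hi'⟩

/-! ### The words `U_{n,k}` as cores of central words -/

theorem IsImage.flipRunMorph_b {j : ℕ} {t c : ℕ → Letter} (h : IsImage (flipRunMorph j) t c)
    {i : ℕ} (hi : c i = Letter.b) :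
    (∃ m, t m = Letter.a ∧ i + 1 = blockPos (flipRunMorph j) t (m + 1)) ∧
      j ≤ i ∧ ∀ l < j, c (i - j + l) = Letter.a := by
  obtain ⟨t₁, h₁, h₂⟩ := h.exists_intermediate fun x => by simp
  obtain ⟨m, hm, hi', hj, ha⟩ := h₂.runMorph_b hi
  refine ⟨⟨m, ?_, ?_⟩, hj, ha⟩
  · rw [isImage_singleton.1 h₁ m] at hm
    rw [← flip_flip (t m), hm]
    rfl
  · rw [hi', flipRunMorph, blockPos_substComp h₁, blockPos_singleton]

theorem wordPow_cons_append (x : Letter) (p : Word) (k : ℕ) :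
    wordPow (x :: p) k ++ [x] = x :: wordPow (p ++ [x]) k :=
  wordPow_conj (x :: p) (p ++ [x]) [x] (by simp) k

theorem wordU_eq {d : ℕ → ℕ} (hd : ∀ i, 1 ≤ i → 1 ≤ d i) (n k : ℕ) :
    wordU d n k = lastLetter (n + 1) :: (wordPow (stdWordAux d (n + 1)) k ++ stdInit d n) := by
  rw [wordU, singWord_append_adjWord hd, singWord_eq, stdWordAux_eq d (n + 1), ← List.cons_append,
    ← wordPow_cons_append]
  simp

/-- For `k ≥ 1`, the word `U_{n,k}` is a central word extended by the same letter on both sides. -/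
theorem wordU_succ {d : ℕ → ℕ} (hd : ∀ i, 1 ≤ i → 1 ≤ d i) (n k : ℕ) :
    wordU d n (k + 1) = stdLast n Letter.a ::
      (subst (stdMorph d n) (List.replicate k Letter.a) ++ centralWord d n ++
        [stdLast n Letter.a]) := by
  have h := centralWord_append_lastLetter d n
  have h' := wordPow_conj (stdWordAux d (n + 1)) _ _ rfl k
  rw [wordU_eq hd, wordPow_succ, ← h', subst_replicate, stdLast, stdMorph, List.append_assoc,
    List.append_assoc, h]
  nth_rw 2 [stdWordAux_eq]
  simp

/-- For `k = d_{n+1}`, just beyond the admissible values, the word `U_{n,k}` is the singular word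
`w_{n+1} = U_{n+2,0}`. -/
theorem wordU_quot {d : ℕ → ℕ} (hd : ∀ i, 1 ≤ i → 1 ≤ d i) (n : ℕ) :
    wordU d n (d (n + 1)) = wordU d (n + 2) 0 := by
  rw [wordU_eq hd, wordU_eq hd, stdInit_add_two, lastLetter_add_two, wordPow_zero, List.nil_append]

theorem wordU_quot_sub_one {d : ℕ → ℕ} (hd : ∀ i, 1 ≤ i → 1 ≤ d i) (n : ℕ) :
    wordU d n (d (n + 1) - 1) = adjWord d ((n : ℤ) - 1) := by
  rw [wordU_eq hd, adjWord_eq]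

/-- The word `U_{n,k}` is centred in the central word `s_n ^ (k+1) s_n s_{n-1}` without its last two
letters. -/
theorem central_eq {d : ℕ → ℕ} (hd : ∀ i, 1 ≤ i → 1 ≤ d i) (n k : ℕ) :
    subst (stdMorph d n) (List.replicate (k + 1) Letter.a) ++ centralWord d n =
      stdInit d (n + 1) ++ wordU d n k ++ (stdInit d (n + 1)).reverse := by
  rw [subst_replicate, centralWord_eq, wordU_eq hd, stdMorph, wordPow_succ]
  nth_rw 1 [stdWordAux_eq]
  simp

theorem wordU_reverse {d : ℕ → ℕ} (hd : ∀ i, 1 ≤ i → 1 ≤ d i) (n k : ℕ) :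
    (wordU d n k).reverse = wordU d n k := by
  have h := (recognizable_stdMorph d n).reverse (List.replicate (k + 1) Letter.a)
  rw [List.reverse_replicate, central_eq hd] at h
  simpa using h

/-- The singular word `w_{n-1}` occurs in `c = stdMorph d n (t)` only in the image of a letter `a`
of `t`, and `w_n` only in the image of a letter `b`. -/
theorem exists_of_occursAt_singWord {d : ℕ → ℕ} (hd : ∀ i, 1 ≤ i → 1 ≤ d i) (n : ℕ)
    {t c : ℕ → Letter} (h : IsImage (stdMorph d n) t c) {i : ℕ} :
    (OccursAt (wordU d n 0) c i →
      ∃ m, t m = Letter.a ∧ i + 1 = blockPos (stdMorph d n) t (m + 1)) ∧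
    (OccursAt (wordU d (n + 1) 0) c i →
      ∃ m, t m = Letter.b ∧ i + 1 = blockPos (stdMorph d n) t (m + 1)) := by
  induction n generalizing t i with
  | zero =>
    rw [stdMorph_zero] at h ⊢
    rw [isImage_singleton] at h
    constructor
    · intro hi
      exact ⟨i, (h i).symm.trans (occursAt_singleton.1 hi), by rw [blockPos_singleton]⟩
    · intro hi
      exact ⟨i, (h i).symm.trans (occursAt_singleton.1 hi), by rw [blockPos_singleton]⟩
  | succ n ih =>
    rw [stdMorph_succ] at h ⊢
    obtain ⟨t₁, h₁, h₂⟩ := h.exists_intermediate (recognizable_flipRunMorph _).ne_nil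
    constructor
    · intro hi
      obtain ⟨m₁, hm₁, hi₁⟩ := (ih h₂).2 hi
      obtain ⟨⟨m, hm, hi'⟩, -⟩ := h₁.flipRunMorph_b hm₁
      exact ⟨m, hm, by rw [blockPos_substComp h₁, hi₁, hi']⟩
    · -- The word `w_{n+1}` is `U_{n,d_{n+1}}`, and stems from `a ^ (d_{n+1} + 1)`.
      intro hi
      obtain ⟨e, he⟩ := Nat.exists_eq_add_of_le' (hd (n + 1) (by omega))
      rw [show n + 1 + 1 = n + 2 from rfl, ← wordU_quot hd, he, wordU_succ hd] at hi
      obtain ⟨m₁, hm₁, hi₁⟩ := (recognizable_stdMorph d n).core h₂ hi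
      have hrep : Letter.a :: (List.replicate e Letter.a ++ [Letter.a]) =
          subst (flipRunMorph (d (n + 1))) [Letter.b] ++
            List.replicate (d (n + 1)) Letter.a := by
        rw [he]
        simp [flipRunMorph_b, List.replicate_succ']
      rw [hrep] at hm₁
      obtain ⟨m, hm, rfl⟩ := (recognizable_flipRunMorph _).sync h₁ hm₁
      have hb := occursAt_singleton.1 hm
      refine ⟨m, hb, ?_⟩
      rw [blockPos_substComp h₁, hi₁, blockPos.eq_2 _ _ m, hb, flipRunMorph_b]
      rfl

/-- Every occurrence of `U_{n,k}` in `c = stdMorph d n (t)` stems from an occurrence of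
`a ^ (k + 1)` in `t`, and is the centre of an occurrence of a longer central word. -/
theorem exists_of_occursAt_wordU {d : ℕ → ℕ} (hd : ∀ i, 1 ≤ i → 1 ≤ d i) {n k : ℕ}
    {t c : ℕ → Letter} (h : IsImage (stdMorph d n) t c) {i : ℕ}
    (hi : OccursAt (wordU d n k) c i) :
    ∃ m, OccursAt (List.replicate (k + 1) Letter.a) t m ∧
      i = blockPos (stdMorph d n) t m + (stdInit d (n + 1)).length := by
  have key : ∃ m, OccursAt (List.replicate (k + 1) Letter.a) t m ∧
      i + 1 = blockPos (stdMorph d n) t (m + 1) := by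
    cases k with
    | zero =>
      obtain ⟨m, hm, hi'⟩ := (exists_of_occursAt_singWord hd n h).1 hi
      exact ⟨m, occursAt_singleton.2 hm, hi'⟩
    | succ k =>
      rw [wordU_succ hd] at hi
      obtain ⟨m, hm, hi'⟩ := (recognizable_stdMorph d n).core h hi
      refine ⟨m, ?_, hi'⟩
      rw [List.replicate_succ, List.replicate_succ']
      exact hm
  obtain ⟨m, hm, hi'⟩ := key
  refine ⟨m, hm, ?_⟩
  have hma : t m = Letter.a := (occursAt_cons.1 hm).1
  rw [blockPos, hma, stdMorph, stdWordAux_eq, List.length_append, List.length_singleton] at hi'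
  omega

/-! ### Palindromic factors -/

theorem not_occursAt_bb {d : ℕ → ℕ} (hd : ∀ i, 1 ≤ i → 1 ≤ d i) {n : ℕ} {γ : ℝ}
    (h : HasContFrac γ (levelQuot d n)) (i : ℕ) :
    ¬ OccursAt [Letter.b, Letter.b] (charWord γ) i := by
  intro hi
  rw [occursAt_cons, occursAt_singleton] at hi
  obtain ⟨γ', -, h'⟩ := h.exists_flipRun
  obtain ⟨-, hle, ha⟩ := h'.flipRunMorph_b hi.2
  have h1 := hd (n + 1) (by omega)
  have := ha (d (n + 1) - 1) (by omega)
  rw [show i + 1 - d (n + 1) + (d (n + 1) - 1) = i by omega, hi.1] at this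
  cases this

/-- In the characteristic word of slope `[0; 1 + d_{n+1}, d_{n+2}, …]`, the blocks of letters `a`
have length at most `d_{n+1} + 1`. -/
theorem not_occursAt_replicate {d : ℕ → ℕ} (hd : ∀ i, 1 ≤ i → 1 ≤ d i) {n : ℕ} {γ : ℝ}
    (h : HasContFrac γ (levelQuot d n)) (i : ℕ) :
    ¬ OccursAt (List.replicate (d (n + 1) + 2) Letter.a) (charWord γ) i := by
  intro hi
  obtain ⟨γ', hγ', h'⟩ := h.exists_flipRun
  have hrep : List.replicate (d (n + 1) + 2) Letter.a =
      subst (flipRunMorph (d (n + 1))) [Letter.b, Letter.b] ++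
        List.replicate (d (n + 1)) Letter.a := by
    simp [flipRunMorph_b, List.replicate_succ]
  rw [hrep] at hi
  obtain ⟨m, hm, -⟩ := (recognizable_flipRunMorph _).sync h' hi
  exact not_occursAt_bb hd hγ' m hm

/-- Every non-empty palindromic factor of `c_α` is an intermediate word between some `U_{n,k}` and
the central word in which it is centred. -/
theorem exists_wordU_of_palindrome {d : ℕ → ℕ} (hd : ∀ i, 1 ≤ i → 1 ≤ d i) {α : ℝ}
    (hα : HasContFrac α (levelQuot d 0)) {u : Word} (hpal : u.Palindrome)
    (hfac : IsFactor u (charWord α)) (hne : u ≠ []) :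
    ∃ (n k : ℕ) (v : Word), k < d (n + 1) ∧ v <:+ stdInit d (n + 1) ∧
      u = v ++ wordU d n k ++ v.reverse := by
  have core : ∀ n k, k ≤ d (n + 1) → ∃ (n' k' : ℕ) (v : Word), k' < d (n' + 1) ∧
      v <:+ stdInit d (n' + 1) ∧ wordU d n k = v ++ wordU d n' k' ++ v.reverse := by
    intro n k hk
    rcases hk.lt_or_eq with hk | rfl
    · exact ⟨n, k, [], hk, List.nil_suffix, by simp⟩
    · exact ⟨n + 2, 0, [], hd _ (by omega), List.nil_suffix, by simp [wordU_quot hd]⟩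
  induction hpal with
  | nil => exact absurd rfl hne
  | singleton x =>
    cases x
    · exact core 0 0 (Nat.zero_le _)
    · exact core 1 0 (Nat.zero_le _)
  | @cons_concat x l hl ih =>
    obtain ⟨i, hi⟩ := hfac
    have hi' := hi
    rw [occursAt_cons, occursAt_append] at hi'
    obtain ⟨hx, hli, -⟩ := hi'
    by_cases hl0 : l = []
    · subst hl0
      cases x
      · exact core 0 1 (hd 1 le_rfl)
      · exact absurd hi (not_occursAt_bb hd hα i)
    obtain ⟨n, k, v, hk, ⟨q, hq⟩, hlv⟩ := ih ⟨_, hli⟩ hl0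
    obtain ⟨γ, hγ, himg⟩ := hα.exists_level n
    rcases List.eq_nil_or_concat q with rfl | ⟨q', y, rfl⟩
    · -- The shorter palindrome is the whole central word: two extensions are conceivable.
      rw [List.nil_append] at hq
      subst hq
      rw [← central_eq hd] at hlv
      obtain ⟨z, rfl⟩ := stdLast_surjective n x
      rw [hlv] at hi ⊢
      obtain ⟨m, hm, -⟩ := (recognizable_stdMorph d n).core himg hi
      cases z
      · -- An occurrence of `a ^ (k + 3)` gives `U_{n,k+2}`.
        rw [← wordU_succ hd]
        refine core n (k + 1 + 1) ?_
        by_contra hlt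
        refine not_occursAt_replicate hd hγ m ?_
        rw [show d (n + 1) + 2 = k + 1 + 1 + 1 by omega, List.replicate_succ, List.replicate_succ']
        exact hm
      · -- An occurrence of `b a ^ (k + 1) b` requires `k + 1 = d_{n+1}`, and gives `U_{n+1,1}`.
        obtain ⟨γ', -, h'⟩ := hγ.exists_flipRun
        rw [occursAt_cons, occursAt_append, occursAt_singleton, List.length_replicate] at hm
        obtain ⟨-, hle, ha⟩ := h'.flipRunMorph_b hm.2.2
        have hkd : k + 1 = d (n + 1) := by
          by_contra hne'
          have := ha (d (n + 1) - (k + 2)) (by omega)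
          rw [show m + 1 + (k + 1) - d (n + 1) + (d (n + 1) - (k + 2)) = m by omega, hm.1] at this
          cases this
        have := core (n + 1) 1 (hd _ (by omega))
        rw [wordU_succ hd (n + 1) 0, stdLast_succ] at this
        rw [hkd, subst_replicate]
        exact this
    · -- All occurrences of the shorter palindrome extend in the same way.
      rw [List.concat_eq_append] at hq
      have hU := hli
      rw [hlv, occursAt_append, occursAt_append] at hU
      obtain ⟨m, hm, hpos⟩ := exists_of_occursAt_wordU hd himg hU.1.2
      have hC := himg.occursAt_subst hm
      have hC' : OccursAt (stdInit d (n + 1)) (charWord α)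
          (blockPos (stdMorph d n) (charWord γ) m) := by
        have := (recognizable_stdMorph d n).lift himg (m + (k + 1))
        have h2 := occursAt_append.2 ⟨hC, by
          rw [← blockPos_add_length hm, List.length_replicate]
          exact this⟩
        rw [central_eq hd, occursAt_append, occursAt_append] at h2
        exact h2.1.1
      rw [← hq, occursAt_append, occursAt_append, occursAt_singleton] at hC'
      have hxy : x = y := by
        rw [← hx, ← hC'.1.2]
        congr 1
        rw [← hq] at hpos
        simp only [List.length_append, List.length_singleton] at hpos
        omega
      subst hxy
      refine ⟨n, k, x :: v, hk, ⟨q', by rw [← hq]; simp⟩, by rw [hlv]; simp⟩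

/-! ### The occurrences of the intermediate palindromes -/

/-- If `t` is the image of `t'` under a morphism such as `a ↦ a`, `b ↦ a ^ (k+1) b`, for which the
occurrences of `a ^ (k + 1)` in `t` are exactly the beginnings of the images of the letters of `t'`,
then the occurrences of a word between `U_{n,k}` and the central word around it in
`c = stdMorph d n (t)` are governed by `t'`. -/
theorem isOccurrenceDecomposition_wordU {d : ℕ → ℕ} (hd : ∀ i, 1 ≤ i → 1 ≤ d i) {n k : ℕ}
    {t t' c : ℕ → Letter} (h : IsImage (stdMorph d n) t c) {ψ : Letter → Word}
    {e : Letter → Letter} (hψ : Recognizable ψ (List.replicate (k + 1) Letter.a) e)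
    (h' : IsImage ψ t' t) {q v : Word} (hq : q ++ v = stdInit d (n + 1))
    {x y : FreeGroup Letter}
    (hx : toGroup (v ++ wordU d n k ++ v.reverse) * x =
      (toGroup q)⁻¹ * toGroup (subst (stdMorph d n) (ψ Letter.a)) * toGroup q)
    (hy : toGroup (v ++ wordU d n k ++ v.reverse) * y =
      (toGroup q)⁻¹ * toGroup (subst (stdMorph d n) (ψ Letter.b)) * toGroup q) :
    IsOccurrenceDecomposition c (toGroup q) (v ++ wordU d n k ++ v.reverse)
      (overAlphabet t' x y) := by
  have hrec := (recognizable_stdMorph d n).comp hψ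
  have himg := h.comp h'
  have hC : ∀ m, OccursAt q c (blockPos (substComp (stdMorph d n) ψ) t' m) ∧
      OccursAt (v ++ wordU d n k ++ v.reverse) c
        (blockPos (substComp (stdMorph d n) ψ) t' m + q.length) := by
    intro m
    have h1 := hrec.lift himg m
    have h2 : stdInit d (n + 1) ++ wordU d n k ++ (stdInit d (n + 1)).reverse =
        q ++ (v ++ wordU d n k ++ v.reverse) ++ q.reverse := by
      rw [← hq]
      simp
    rw [central_eq hd, h2, occursAt_append, occursAt_append] at h1
    exact h1.1
  refine ⟨fun m => blockPos (substComp (stdMorph d n) ψ) t' m + q.length,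
    fun m m' hm => Nat.add_lt_add_right (blockPos_strictMono hrec.ne_nil hm) _,
    fun i => ⟨fun hi => ?_, ?_⟩, ?_, fun m => ?_⟩
  · rw [occursAt_append, occursAt_append] at hi
    obtain ⟨m₁, hm₁, hi₁⟩ := exists_of_occursAt_wordU hd h hi.1.2
    obtain ⟨m, -, rfl⟩ := hψ.sync h' (u := []) hm₁
    refine ⟨m, ?_⟩
    rw [← hq, List.length_append] at hi₁
    simp only [blockPos_substComp h']
    omega
  · rintro ⟨m, rfl⟩
    exact (hC m).2
  · have h1 : segment c 0 (0 + q.length) = q := (hC 0).1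
    change _ = toGroup (segment c 0 (0 + q.length))
    rw [h1]
  · -- The return words are the blocks conjugated by the prefix `q`.
    set p := blockPos (substComp (stdMorph d n) ψ) t'
    have hle : p (m + 1) = p m + (substComp (stdMorph d n) ψ (t' m)).length := rfl
    have h1 : segment c (p m) (p m + q.length) = q := (hC m).1
    have h2 : segment c (p (m + 1)) (p (m + 1) + q.length) = q := (hC (m + 1)).1
    have h3 : segment c (p m) (p (m + 1)) = substComp (stdMorph d n) ψ (t' m) :=
      segment_blockPos himg m
    have h4 := segment_append c (p m) q.length (substComp (stdMorph d n) ψ (t' m)).length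
    have h5 := segment_append c (p m) (substComp (stdMorph d n) ψ (t' m)).length q.length
    rw [add_comm q.length, ← h5, ← hle, h1, h2, h3,
      show p m + q.length + (substComp (stdMorph d n) ψ (t' m)).length = p (m + 1) + q.length by
        omega] at h4
    have h6 := congrArg toGroup h4
    rw [toGroup_append, toGroup_append] at h6
    have h7 : toGroup (segment c (p m + q.length) (p (m + 1) + q.length)) =
        (toGroup q)⁻¹ * toGroup (substComp (stdMorph d n) ψ (t' m)) * toGroup q := by
      rw [mul_assoc, ← h6, inv_mul_cancel_left]
    rw [h7]
    unfold overAlphabet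
    cases htm : t' m
    · exact hx
    · exact hy

/-! ### Identities in the free group -/

theorem toGroup_nil : toGroup [] = 1 := rfl

theorem toGroup_wordPow (x : Word) (m : ℕ) : toGroup (wordPow x m) = toGroup x ^ m := by
  induction m with
  | zero => rfl
  | succ m ih => rw [wordPow_succ, toGroup_append, ih, pow_succ']

theorem toGroup_stdInit (d : ℕ → ℕ) (m : ℕ) :
    toGroup (stdInit d m) = toGroup (stdWordAux d m) * (FreeGroup.of (lastLetter m))⁻¹ := by
  rw [stdWordAux_eq, toGroup_append, toGroup_cons, toGroup_nil]
  group

/-- The words `w_{n-1} v_{n-2}` and `s_n` are conjugate. -/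
theorem toGroup_singWord_mul_adjWord {d : ℕ → ℕ} (hd : ∀ i, 1 ≤ i → 1 ≤ d i) (n : ℕ) :
    toGroup (singWord d ((n : ℤ) - 1)) * toGroup (adjWord d ((n : ℤ) - 2)) =
      (toGroup (stdInit d (n + 1)))⁻¹ * toGroup (stdWordAux d (n + 1)) *
        toGroup (stdInit d (n + 1)) := by
  rw [← toGroup_append, singWord_append_adjWord hd, toGroup_cons, toGroup_stdInit]
  group

theorem toGroup_wordU (d : ℕ → ℕ) (n k : ℕ) :
    toGroup (wordU d n k) =
      toGroup (singWord d ((n : ℤ) - 1)) * toGroup (adjWord d ((n : ℤ) - 2)) *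
        groupU d n ((k : ℤ) - 1) := by
  unfold groupU
  cases k with
  | zero => simp [wordU, wordPow_zero]
  | succ k =>
    have h1 : ((k + 1 : ℕ) : ℤ) - 1 = k := by push_cast; ring
    rw [h1, if_neg (by omega), Int.toNat_natCast, wordU, wordU, wordPow_succ]
    simp only [toGroup_append, mul_assoc]

theorem toGroup_wordUbar (d : ℕ → ℕ) (n k : ℕ) :
    toGroup (wordUbar d n k) =
      toGroup (adjWord d ((n : ℤ) - 2)) * toGroup (singWord d ((n : ℤ) - 1)) *
        groupUbar d n ((k : ℤ) - 1) := by
  unfold groupUbar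
  cases k with
  | zero => simp [wordUbar, wordPow_zero]
  | succ k =>
    have h1 : ((k + 1 : ℕ) : ℤ) - 1 = k := by push_cast; ring
    rw [h1, if_neg (by omega), Int.toNat_natCast, wordUbar, wordUbar, wordPow_succ]
    simp only [toGroup_append, mul_assoc]

theorem toGroup_wordU_mul {d : ℕ → ℕ} (hd : ∀ i, 1 ≤ i → 1 ≤ d i) (n k : ℕ) :
    toGroup (wordU d n k) * toGroup (singWord d n) =
      (toGroup (stdInit d (n + 1)))⁻¹ * (toGroup (stdWordAux d (n + 1)) ^ (k + 1) *
        toGroup (stdWordAux d n)) * toGroup (stdInit d (n + 1)) := by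
  have h1 := singWord_eq d (n + 1)
  rw [show ((n + 1 : ℕ) : ℤ) - 1 = n by push_cast; ring] at h1
  rw [h1, wordU_eq hd, toGroup_cons, toGroup_append, toGroup_wordPow, toGroup_cons,
    toGroup_stdInit, toGroup_stdInit, lastLetter_add_two, pow_succ']
  group

/-- The words `v_{n-1} w_n` and `s_{n+1}` are conjugate, too. -/
theorem toGroup_adjWord_mul_singWord {d : ℕ → ℕ} (hd : ∀ i, 1 ≤ i → 1 ≤ d i) (n : ℕ) :
    toGroup (adjWord d ((n : ℤ) - 1)) * toGroup (singWord d n) =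
      (toGroup (stdInit d (n + 1)))⁻¹ * toGroup (stdWordAux d (n + 2)) *
        toGroup (stdInit d (n + 1)) := by
  have h1 := singWord_eq d (n + 1)
  rw [show ((n + 1 : ℕ) : ℤ) - 1 = n by push_cast; ring] at h1
  have h2 := congrArg toGroup (stdInit_append_adjWord hd n)
  rw [toGroup_append] at h2
  rw [h1, eq_inv_mul_of_mul_eq h2, toGroup_cons, toGroup_stdInit d (n + 2)]
  group

theorem wordUbar_succ (d : ℕ → ℕ) (n k : ℕ) :
    wordUbar d n (k + 1) = adjWord d ((n : ℤ) - 2) ++ wordU d n k ++ adjWord d ((n : ℤ) - 2) := by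
  have h := wordPow_conj (adjWord d ((n : ℤ) - 2) ++ singWord d ((n : ℤ) - 1))
    (singWord d ((n : ℤ) - 1) ++ adjWord d ((n : ℤ) - 2)) (adjWord d ((n : ℤ) - 2)) (by simp) k
  rw [wordUbar, wordU, wordPow_succ, List.append_assoc, h]
  have h' := wordPow_conj (singWord d ((n : ℤ) - 1) ++ adjWord d ((n : ℤ) - 2)) _ _ rfl k
  simp only [List.append_assoc] at h' ⊢
  rw [h']

theorem adjWord_reverse {d : ℕ → ℕ} (hd : ∀ i, 1 ≤ i → 1 ≤ d i) (n : ℕ) :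
    (adjWord d ((n : ℤ) - 1)).reverse = adjWord d ((n : ℤ) - 1) := by
  rw [← wordU_quot_sub_one hd, wordU_reverse hd]

theorem IsProperSuffix.suffix_of_cons {x : Letter} {v w : Word} (h : IsProperSuffix v (x :: w)) :
    v <:+ w :=
  (List.suffix_cons_iff.1 h.1).resolve_left h.2

theorem isProperSuffix_cons {x : Letter} {v w : Word} (h : v <:+ w) : IsProperSuffix v (x :: w) :=
  ⟨h.trans (List.suffix_cons _ _), fun he => by
    have := h.length_le
    rw [he, List.length_cons] at this
    omega⟩

end SturmianPalindromes

theorem mainTheorem1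
    (d : ℕ → ℕ) (hd : ∀ i, 1 ≤ i → 1 ≤ d i)
    (α : ℝ) (hα : HasContFrac α (shiftQuot d 0 0))
    (u : Word) (hpal : u.reverse = u) (hfac : IsFactor u (charWord α)) (hlen : 2 ≤ u.length) :
    -- (1) the case `u = v U_{n,k} ṽ`
    (∀ (n k : ℕ) (v : Word), 1 ≤ n → IsProperSuffix v (adjWord d (n - 2)) → k + 2 ≤ d (n + 1) →
      u = v ++ wordU d n k ++ v.reverse →
      ∃ γ : ℝ, HasContFrac γ (shiftQuot d n (-k)) ∧
        IsOccurrenceDecomposition (charWord α)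
          (toGroup (adjProd d n) * (toGroup v)⁻¹) u
          (overAlphabet (charWord γ)
            (toGroup v * groupU d n (k - 1) * toGroup v.reverse)⁻¹
            ((toGroup v.reverse)⁻¹ * toGroup (singWord d n) * (toGroup v)⁻¹))) ∧
    -- (2) the case `u = v Ū_{n,k} ṽ`
    (∀ (n k : ℕ) (v : Word), 1 ≤ n → IsProperSuffix v (singWord d (n - 1)) → k + 1 ≤ d (n + 1) →
      u = v ++ wordUbar d n k ++ v.reverse →
      ∃ γ : ℝ, HasContFrac γ (shiftQuot d n (1 - k)) ∧
        IsOccurrenceDecomposition (charWord α)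
          (toGroup (adjProd d (n - 1)) * (toGroup v)⁻¹) u
          (overAlphabet (charWord γ)
            (toGroup v * groupUbar d n (k - 1) * toGroup v.reverse)⁻¹
            (toGroup v * groupU d (n - 1) (d n - 2) * toGroup v.reverse)⁻¹)) ∧
    -- the case `u = a ^ k`
    (∀ k : ℕ, 2 ≤ k → k + 1 ≤ d 1 → u = wordPow [Letter.a] k →
      ∃ γ : ℝ, HasContFrac γ (shiftQuot d 0 (-k)) ∧
        IsOccurrenceDecomposition (charWord α) 1 u
          (overAlphabet (charWord γ)
            (toGroup (wordPow [Letter.a] (k - 1)))⁻¹ (toGroup [Letter.b]))) ∧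
    -- every palindromic factor of length at least two falls under one of the three cases
    ((∃ (n k : ℕ) (v : Word), 1 ≤ n ∧ IsProperSuffix v (adjWord d (n - 2)) ∧ k + 2 ≤ d (n + 1) ∧
        u = v ++ wordU d n k ++ v.reverse) ∨
      (∃ (n k : ℕ) (v : Word), 1 ≤ n ∧ IsProperSuffix v (singWord d (n - 1)) ∧ k + 1 ≤ d (n + 1) ∧
        u = v ++ wordUbar d n k ++ v.reverse) ∨
      (∃ k : ℕ, 2 ≤ k ∧ k + 1 ≤ d 1 ∧ u = wordPow [Letter.a] k)) := by
  rw [shiftQuot_zero] at hα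
  have hα' : HasContFrac α (levelQuot d 0) := by
    convert hα using 2 with i
    split_ifs with hi
    · simp [hi]
    · rfl
  refine ⟨?_, ?_, ?_, ?_⟩
  · intro n k v hn hv hk hu
    subst hu
    obtain ⟨n, rfl⟩ := Nat.exists_eq_add_of_le' hn
    obtain ⟨γ₁, hγ₁, himg₁⟩ := hα'.exists_level (n + 1)
    obtain ⟨γ, hγ, himg⟩ := hγ₁.exists_run (k + 1) (by simp only [levelQuot, if_true]; omega)
    rw [cast_succ_sub_two] at hv
    obtain ⟨q, hq⟩ : v <:+ stdInit d (n + 1 + 1) :=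
      hv.1.trans ⟨_, stdInit_append_adjWord hd n⟩
    have hqg : toGroup (stdInit d (n + 1 + 1)) * (toGroup v)⁻¹ = toGroup q := by
      rw [← hq, toGroup_append, mul_inv_cancel_right]
    have hqg' : toGroup q = toGroup (stdInit d (n + 1 + 1)) * (toGroup v)⁻¹ := hqg.symm
    refine ⟨γ, ?_, ?_⟩
    · rw [shiftQuot_succ]
      convert hγ using 4
      push_cast
      ring
    · rw [adjProd_eq hd, hqg]
      refine isOccurrenceDecomposition_wordU hd himg₁ (recognizable_runMorph (k + 1)) himg hq ?_ ?_
      · have h1 := toGroup_singWord_mul_adjWord hd (n + 1)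
        have h2 := toGroup_wordU d (n + 1) k
        rw [h1] at h2
        rw [toGroup_append, toGroup_append, h2, hqg']
        simp only [runMorph, subst_cons, subst_nil, List.append_nil, stdMorph]
        group
      · have h1 := toGroup_wordU_mul hd (n + 1) k
        simp only [runMorph, subst_append, subst_replicate, subst_cons, subst_nil, List.append_nil,
          stdMorph, toGroup_append, toGroup_wordPow]
        calc _ = toGroup v * (toGroup (wordU d (n + 1) k) * toGroup (singWord d (n + 1 : ℕ))) *
              (toGroup v)⁻¹ := by group
          _ = _ := by
            rw [h1, hqg']
            group
  · intro n k v hn hv hk hu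
    obtain ⟨n, rfl⟩ := Nat.exists_eq_add_of_le' hn
    have hcast : ((n + 1 : ℕ) : ℤ) - 1 = n := by push_cast; ring
    rw [singWord_eq] at hv
    obtain ⟨q, hq⟩ := hv.suffix_of_cons
    have hqg : toGroup (stdInit d (n + 1)) * (toGroup v)⁻¹ = toGroup q := by
      rw [← hq, toGroup_append, mul_inv_cancel_right]
    have hqg' : toGroup q = toGroup (stdInit d (n + 1)) * (toGroup v)⁻¹ := hqg.symm
    rw [Nat.add_sub_cancel, adjProd_eq hd, hqg]
    have hA := toGroup_adjWord_mul_singWord hd n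
    -- The identities for the two return words hold for all `k`.
    have hx : toGroup u * (toGroup v * groupUbar d (n + 1) (k - 1) * toGroup v.reverse)⁻¹ =
        (toGroup q)⁻¹ * toGroup (stdWordAux d (n + 2)) * toGroup q := by
      have h2 := toGroup_wordUbar d (n + 1) k
      rw [cast_succ_sub_two, hcast, hA] at h2
      rw [hu, toGroup_append, toGroup_append, h2, hqg']
      group
    have hy : toGroup u * (toGroup v * groupU d n (d (n + 1) - 2) * toGroup v.reverse)⁻¹ =
        (toGroup q)⁻¹ * (toGroup (stdWordAux d (n + 2)) ^ k * toGroup (stdWordAux d (n + 1))) *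
          toGroup q := by
      have h1 := toGroup_wordU d n (d (n + 1) - 1)
      rw [toGroup_singWord_mul_adjWord hd, wordU_quot_sub_one hd,
        show ((d (n + 1) - 1 : ℕ) : ℤ) - 1 = (d (n + 1) : ℤ) - 2 by
          have := hd (n + 1) (by omega)
          omega] at h1
      have h2 : toGroup (wordUbar d (n + 1) k) =
          ((toGroup (stdInit d (n + 1)))⁻¹ * toGroup (stdWordAux d (n + 2)) ^ k *
            toGroup (stdInit d (n + 1))) * toGroup (adjWord d ((n : ℤ) - 1)) := by
        rw [wordUbar, toGroup_append, toGroup_wordPow, toGroup_append, cast_succ_sub_two, hcast, hA]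
        congr 1
        have := conj_pow (i := k) (a := (toGroup (stdInit d (n + 1)))⁻¹)
          (b := toGroup (stdWordAux d (n + 2)))
        rwa [inv_inv] at this
      rw [hu, toGroup_append, toGroup_append, h2, h1, hqg']
      group
    cases k with
    | zero =>
      -- The word `v_{n-1}` is `U_{n,k}` for the largest admissible `k`.
      obtain ⟨γ₁, hγ₁, himg₁⟩ := hα'.exists_level n
      obtain ⟨γ, hγ, himg⟩ := hγ₁.exists_flipRun
      have hu' : u = v ++ wordU d n (d (n + 1) - 1) ++ v.reverse := by
        rw [hu, wordU_quot_sub_one hd, wordUbar, cast_succ_sub_two, wordPow_zero, List.nil_append]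
      have hd1 : d (n + 1) - 1 + 1 = d (n + 1) := Nat.sub_add_cancel (hd _ (by omega))
      refine ⟨γ, ?_, ?_⟩
      · rw [shiftQuot_succ]
        convert hγ using 2 with i
        split_ifs with hi
        · simp [hi]
        · rfl
      · rw [hu'] at hx hy ⊢
        refine isOccurrenceDecomposition_wordU hd himg₁
          (by rw [hd1]; exact recognizable_flipRunMorph _) himg hq ?_ ?_
        · rw [hx]
          exact congrArg (fun w => (toGroup q)⁻¹ * toGroup w * toGroup q)
            (congrFun (stdMorph_succ d n) Letter.a)
        · rw [hy, pow_zero, one_mul]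
          exact congrArg (fun w => (toGroup q)⁻¹ * toGroup w * toGroup q)
            (congrFun (stdMorph_succ d n) Letter.b)
    | succ k =>
      obtain ⟨γ₁, hγ₁, himg₁⟩ := hα'.exists_level (n + 1)
      obtain ⟨γ, hγ, himg⟩ := hγ₁.exists_run (k + 1) (by simp only [levelQuot, if_true]; omega)
      have hu' : u = (v ++ adjWord d ((n : ℤ) - 1)) ++ wordU d (n + 1) k ++
          (v ++ adjWord d ((n : ℤ) - 1)).reverse := by
        rw [hu, wordUbar_succ, cast_succ_sub_two, List.reverse_append, adjWord_reverse hd]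
        simp
      refine ⟨γ, ?_, ?_⟩
      · rw [shiftQuot_succ]
        convert hγ using 4
        push_cast
        ring
      · rw [hu'] at hx hy ⊢
        refine isOccurrenceDecomposition_wordU hd himg₁ (recognizable_runMorph (k + 1)) himg
          (by rw [← List.append_assoc, hq, stdInit_append_adjWord hd]) ?_ ?_
        · rw [hx]
          simp only [runMorph, subst_cons, subst_nil, List.append_nil, stdMorph]
        · rw [hy]
          simp only [runMorph, subst_append, subst_replicate, subst_cons, subst_nil,
            List.append_nil, stdMorph, toGroup_append, toGroup_wordPow]
  · intro k hk2 hk hu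
    obtain ⟨k, rfl⟩ := Nat.exists_eq_add_of_le' (show 1 ≤ k by omega)
    obtain ⟨γ, hγ, himg⟩ := hα'.exists_run (k + 1) (by
      simp only [levelQuot, if_true, zero_add]
      omega)
    have hid : IsImage (stdMorph d 0) (charWord α) (charWord α) := by
      rw [stdMorph_zero, isImage_singleton]
      exact fun _ => rfl
    have hu' : u = [] ++ wordU d 0 k ++ List.reverse [] := by
      rw [hu, wordU_eq hd]
      simp [wordPow_succ, stdInit, stdWordAux, lastLetter]
    refine ⟨γ, ?_, ?_⟩
    · rw [shiftQuot_zero]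
      convert hγ using 4
      rw [sub_eq_add_neg]
    · have hpow : toGroup u = FreeGroup.of Letter.a ^ (k + 1) := by
        rw [hu, toGroup_wordPow]
        rfl
      have ha : toGroup [Letter.a] = FreeGroup.of Letter.a := rfl
      have hq : ([] : Word) ++ [] = stdInit d (0 + 1) := rfl
      rw [hu'] at hpow ⊢
      refine isOccurrenceDecomposition_wordU hd hid (recognizable_runMorph (k + 1)) himg
        hq ?_ ?_
      · rw [hpow]
        simp only [runMorph, subst_cons, subst_nil, List.append_nil, stdMorph, toGroup_nil,
          stdWordAux, toGroup_wordPow, ha, Nat.add_sub_cancel]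
        group
      · rw [hpow]
        simp only [runMorph, subst_append, subst_replicate, subst_cons, subst_nil,
          List.append_nil, stdMorph, toGroup_append, toGroup_wordPow, toGroup_nil, stdWordAux, ha]
        group
  · have hne : u ≠ [] := by
      rintro rfl
      simp at hlen
    obtain ⟨n, k, v, hk, hv, hu⟩ := exists_wordU_of_palindrome hd hα'
      (List.Palindrome.of_reverse_eq hpal) hfac hne
    by_cases hk' : k + 1 = d (n + 1)
    · -- The word `U_{n,k}` is `v_{n-1}`.
      refine Or.inr (Or.inl ⟨n + 1, 0, v, by omega, ?_, hd _ (by omega), ?_⟩)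
      · rw [singWord_eq]
        exact isProperSuffix_cons hv
      · rw [hu, show k = d (n + 1) - 1 by omega, wordU_quot_sub_one hd, wordUbar,
          cast_succ_sub_two, wordPow_zero, List.nil_append]
    cases n with
    | zero =>
      obtain rfl : v = [] := List.suffix_nil.1 hv
      have hu' : u = wordPow [Letter.a] (k + 1) := by
        rw [hu, wordU_eq hd]
        simp [wordPow_succ, stdInit, stdWordAux, lastLetter]
      refine Or.inr (Or.inr ⟨k + 1, ?_, by simp at hk hk'; omega, hu'⟩)
      rw [hu', wordPow_singleton, List.length_replicate] at hlen
      exact hlen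
    | succ n =>
      have hs := stdInit_append_adjWord hd n
      have hadj : adjWord d ((n : ℤ) - 1) <:+ stdInit d (n + 1 + 1) := ⟨_, hs⟩
      -- If `v` is not shorter than `v_{n-1}`, then `u` contains some `Ū_{n+1,k+1}` centrally.
      have case2 : ∀ v', v' ++ adjWord d ((n : ℤ) - 1) = v →
          ∃ (n k : ℕ) (v : Word), 1 ≤ n ∧ IsProperSuffix v (singWord d (n - 1)) ∧
            k + 1 ≤ d (n + 1) ∧ u = v ++ wordUbar d n k ++ v.reverse := by
        rintro v' rfl
        refine ⟨n + 1, k + 1, v', by omega, ?_, by omega, ?_⟩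
        · obtain ⟨q, hq⟩ := hv
          rw [← hs, ← List.append_assoc] at hq
          rw [singWord_eq]
          exact isProperSuffix_cons ⟨q, List.append_cancel_right hq⟩
        · rw [hu, wordUbar_succ, cast_succ_sub_two, List.reverse_append, adjWord_reverse hd]
          simp
      rcases List.suffix_or_suffix_of_suffix hv hadj with h | ⟨v', hv'⟩
      · by_cases he : v = adjWord d ((n : ℤ) - 1)
        · exact Or.inr (Or.inl (case2 [] he.symm))
        · exact Or.inl ⟨n + 1, k, v, by omega, by rw [cast_succ_sub_two]; exact ⟨h, he⟩,
            by omega, hu⟩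
      · exact Or.inr (Or.inl (case2 v' hv'))
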